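/- For an integer $Q\ge 2$ let $M(Q)$ be the finite sequence of all fractions $p/q$ indexed by the pairs of integers $(p,q)$ with $1\le p<q\le Q$ (so that equal fractions are counted with multiplicity), and let $N=N(Q)=Q(Q-1)/2$ be its number of terms $x_1,\dots,x_N$. Let $I\subset(0,1)$ be any interval of positive length $|I|$. For $\lambda>0$ put $$R_{I,Q}(\lambda)=\frac{1}{2N|I|}\,\#\Big\{(i,j): 1\le i,j\le N,\ i\neq j,\ x_i,x_j\in I,\ 0<|x_i-x_j|\le \frac{\lambda}{N}\Big\}.$$ Let $$g(x)=\frac{6}{\pi^2x^2}\sum_{1\le k\le 2x}\sigma(k)\log\frac{2x}{k}\qquad(x>0),$$ where $\sigma(k)$ is the sum of the positive divisors of $k$. Then the limiting pair correlation function of $(M(Q)\cap I)_{Q}$ exists and equals $g$, independently of $I$; that is, for every $\lambda>0$ the function $g$ is integrable on $(0,\lambda]$ and $$\lim_{Q\to\infty}R_{I,Q}(\lambda)=\int_0^\lambda g(x)\,dx .$$ -/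

import Mathlib

open MeasureTheory Filter Topology

noncomputable section

namespace FracPairCorr

/-- Index set of the finite sequence `M(Q)`: the pairs `(p, q)` with `1 ≤ p < q ≤ Q`. The entry with
index `(p, q)` is the fraction `p / q`, so equal fractions are kept with their multiplicity. -/
def indices (Q : ℕ) : Finset (ℕ × ℕ) :=
  (Finset.Icc 1 Q ×ˢ Finset.Icc 1 Q).filter fun i => i.1 < i.2

/-- The entry `p / q` of `M(Q)` with index `(p, q)`. -/
def point (i : ℕ × ℕ) : ℝ := (i.1 : ℝ) / (i.2 : ℝ)

/-- The number `N = Q (Q - 1) / 2` of entries of `M(Q)`. -/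
def numPoints (Q : ℕ) : ℝ := (Q : ℝ) * ((Q : ℝ) - 1) / 2

open scoped Classical in
/-- The ordered pairs of distinct indices of entries of `M(Q)` lying in `I` whose values are
different and at distance at most `lam / N`. -/
def closePairs (I : Set ℝ) (Q : ℕ) (lam : ℝ) : Finset ((ℕ × ℕ) × (ℕ × ℕ)) :=
  (indices Q ×ˢ indices Q).filter fun ij =>
    point ij.1 ∈ I ∧ point ij.2 ∈ I ∧ ij.1 ≠ ij.2 ∧
      0 < |point ij.1 - point ij.2| ∧ |point ij.1 - point ij.2| ≤ lam / numPoints Q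

/-- `R_{M_I(Q)}(lam)`: the number of close pairs divided by `2 N |I|`, with `|I|` the length of the
interval `I`. -/
def pairCorr (I : Set ℝ) (Q : ℕ) (lam : ℝ) : ℝ :=
  ((closePairs I Q lam).card : ℝ) / (2 * numPoints Q * volume.real I)

/-- `g` is the pair correlation function of `(M(Q) ∩ I)_Q`: for every `lam > 0` the limit of
`R_{M_I(Q)}(lam)` as `Q → ∞` exists and equals the (convergent) integral of `g` over `[0, lam]`. -/
def IsPairCorrelationFunction (I : Set ℝ) (g : ℝ → ℝ) : Prop :=
  ∀ lam : ℝ, 0 < lam →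
    IntervalIntegrable g volume 0 lam ∧
      Tendsto (fun Q : ℕ => pairCorr I Q lam) atTop (𝓝 (∫ x in (0 : ℝ)..lam, g x))

/-- `x ↦ 6 / (π² x²) * ∑_{1 ≤ k ≤ 2 x} σ(k) log (2 x / k)`. -/
def density (x : ℝ) : ℝ :=
  6 / (Real.pi ^ 2 * x ^ 2) *
    ∑ k ∈ Finset.Icc 1 ⌊2 * x⌋₊,
      (ArithmeticFunction.sigma 1 k : ℝ) * Real.log (2 * x / (k : ℝ))

end FracPairCorr

end

/-!
Split the close pairs `p / q > p' / q'` by their determinant `k = p q' - p' q`. The two fractions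
differ by `k / (q q')`, so they are close when `q q' ≥ k N / λ`, which forces `k ≤ 2 λ` as
`Q → ∞`, and `(q, q') / Q` lies above a hyperbola `x y = c` in the unit square.

*Upper bound, for all of `(0, 1)`.* Given `(q, q')`, the numerator `p` is determined modulo
`q / gcd(q, q')`, and it exists only if `gcd(q, q') ∣ k`. The weight `gcd(q, q')` restricted to
`gcd(q, q') ∣ k` has mean `6 σ(k) / (π² k)`, and the region `x y ≥ c` has area `1 - c + c log c`.

*Lower bound, for a subinterval.* Fix a fraction `n / m` and consider the pairs whose slope
`q' / q` is slightly larger than `n / m`. Under the linear map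
`(p, q, p', q') ↦ (D, a) = (q' m - q n, p' m - p n)` one has
`p / q = a / D + m k / (q D)` and `q' / q = n / m + D / (m q)`, so that the position of the
fractions is governed by `a / D` and their slope by `D / q`. Over a given `(D, a)` with
`gcd(D, a) ∣ k` the denominators `q` form an arithmetic progression of step `m D / gcd(D, a)`,
while `(D, a)` ranges over a trapezoid, where the weight `gcd(D, a)` equidistributes. By Vitali's
theorem disjoint slope windows of this kind fill `[c, 1 / c]`, and summing over them gives the
expected density.

The upper bound for a subinterval follows by subtracting from the upper bound for `(0, 1)` the
lower bounds for the two complementary intervals. Finally `1 - c + c log c` has derivative `log c`,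
which turns the limit into the integral of the density.
-/

noncomputable section

namespace FracPairCorr

open ArithmeticFunction (sigma moebius)
open scoped Pointwise

open scoped Classical in
/-- The pairs `v` of positive integers with `v / Q ∈ S`, for a region `S` in the unit square. -/
def latticePoints (S : Set (ℝ × ℝ)) (Q : ℕ) : Finset (ℕ × ℕ) :=
  (Finset.Icc 1 Q ×ˢ Finset.Icc 1 Q).filter fun v => ((v.1 : ℝ) / Q, (v.2 : ℝ) / Q) ∈ S

theorem mem_latticePoints {S : Set (ℝ × ℝ)} {Q : ℕ} {v : ℕ × ℕ} :
    v ∈ latticePoints S Q ↔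
      ((1 ≤ v.1 ∧ v.1 ≤ Q) ∧ 1 ≤ v.2 ∧ v.2 ≤ Q) ∧ ((v.1 : ℝ) / Q, (v.2 : ℝ) / Q) ∈ S := by
  simp [latticePoints]

/-- Jordan measurable subsets of the unit square, the axes being removed because `latticePoints`
only sees positive coordinates. -/
structure IsJordanRegion (S : Set (ℝ × ℝ)) : Prop where
  subset : S ⊆ Set.Ioc 0 1 ×ˢ Set.Ioc 0 1
  measurableSet : MeasurableSet S
  volume_frontier : volume (frontier S) = 0

namespace IsJordanRegion

variable {S : Set (ℝ × ℝ)}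

theorem of_convex (hsubset : S ⊆ Set.Ioc 0 1 ×ˢ Set.Ioc 0 1) (hmeas : MeasurableSet S)
    (hconvex : Convex ℝ S) : IsJordanRegion S :=
  ⟨hsubset, hmeas, hconvex.addHaar_frontier volume⟩

theorem mem_latticePoints_iff (hS : IsJordanRegion S) {Q : ℕ} (hQ : 0 < Q) {v : ℕ × ℕ} :
    v ∈ latticePoints S Q ↔ ((v.1 : ℝ) / Q, (v.2 : ℝ) / Q) ∈ S := by
  refine mem_latticePoints.trans (and_iff_right_of_imp fun hv => ?_)
  have hQ' : (0 : ℝ) < Q := by exact_mod_cast hQ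
  have bounds : ∀ a : ℕ, (a : ℝ) / Q ∈ Set.Ioc (0 : ℝ) 1 → 1 ≤ a ∧ a ≤ Q := fun a ha =>
    ⟨Nat.cast_pos.1 ((div_pos_iff_of_pos_right hQ').1 ha.1),
      Nat.cast_le.1 ((div_le_one hQ').1 ha.2)⟩
  exact ⟨bounds _ (hS.subset hv).1, bounds _ (hS.subset hv).2⟩

theorem preimage_smul (hS : IsJordanRegion S) {e : ℕ} (he : 0 < e) :
    IsJordanRegion ((fun p : ℝ × ℝ => (e : ℝ) • p) ⁻¹' S) := by
  have he' : (1 : ℝ) ≤ e := by exact_mod_cast he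
  have he0 : (e : ℝ) ≠ 0 := by positivity
  have mem_Ioc : ∀ x : ℝ, (e : ℝ) * x ∈ Set.Ioc (0 : ℝ) 1 → x ∈ Set.Ioc (0 : ℝ) 1 := fun x hx => by
    have hx0 : 0 < x := pos_of_mul_pos_right hx.1 (by positivity)
    exact ⟨hx0, (le_mul_of_one_le_left hx0.le he').trans hx.2⟩
  refine ⟨fun p hp => ⟨mem_Ioc _ (hS.subset hp).1, mem_Ioc _ (hS.subset hp).2⟩,
    hS.measurableSet.preimage (measurable_const_smul _), ?_⟩
  have hfrontier := (Homeomorph.smulOfNeZero (α := ℝ × ℝ) (e : ℝ) he0).preimage_frontier S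
  simp only [Homeomorph.smulOfNeZero_apply] at hfrontier
  rw [← hfrontier, Measure.addHaar_preimage_smul volume he0, hS.volume_frontier, mul_zero]

end IsJordanRegion

theorem volume_real_preimage_smul (S : Set (ℝ × ℝ)) {e : ℝ} (he : e ≠ 0) :
    volume.real ((fun p : ℝ × ℝ => e • p) ⁻¹' S) = volume.real S / e ^ 2 := by
  rw [measureReal_def, Measure.addHaar_preimage_smul volume he, ENNReal.toReal_mul,
    ENNReal.toReal_ofReal (abs_nonneg _), ← measureReal_def]
  rw [Module.finrank_prod, Module.finrank_self, one_add_one_eq_two, abs_of_nonneg (by positivity),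
    inv_mul_eq_div]

theorem IsJordanRegion.card_latticePoints_eq {S : Set (ℝ × ℝ)} (hS : IsJordanRegion S) {Q : ℕ}
    (hQ : 0 < Q) :
    (latticePoints S Q).card =
      Nat.card ↑((MeasurableEquiv.finTwoArrow ⁻¹' S : Set (Fin 2 → ℝ)) ∩
        (Q : ℝ)⁻¹ • (Submodule.span ℤ (Set.range (Pi.basisFun ℝ (Fin 2))) : Set (Fin 2 → ℝ))) := by
  have hQ' : (0 : ℝ) < Q := by exact_mod_cast hQ
  rw [← Set.ncard_coe_finset, Nat.card_coe_set_eq]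
  refine Set.ncard_congr (fun v _ => ![(v.1 : ℝ) / Q, (v.2 : ℝ) / Q]) (fun v hv => ⟨?_, ?_⟩) ?_ ?_
  · exact (mem_latticePoints.1 hv).2
  · rw [Set.mem_inv_smul_set_iff₀ hQ'.ne', SetLike.mem_coe, Module.Basis.mem_span_iff_repr_mem]
    intro i
    fin_cases i
    exacts [⟨v.1, by simp [field]⟩, ⟨v.2, by simp [field]⟩]
  · intro v w _ _ hvw
    have hfst := congrFun hvw 0
    have hsnd := congrFun hvw 1
    simp only [Matrix.cons_val_zero, Matrix.cons_val_one, div_left_inj' hQ'.ne',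
      Nat.cast_inj] at hfst hsnd
    exact Prod.ext hfst hsnd
  · rintro x ⟨hxS, hxL⟩
    rw [Set.mem_inv_smul_set_iff₀ hQ'.ne', SetLike.mem_coe,
      Module.Basis.mem_span_iff_repr_mem] at hxL
    have hxS' : (x 0, x 1) ∈ S := hxS
    have exists_nat : ∀ i, 0 < x i → ∃ a : ℕ, (a : ℝ) / Q = x i := fun i hi => by
      obtain ⟨z, hz⟩ := hxL i
      simp only [Pi.basisFun_repr, Pi.smul_apply, smul_eq_mul, algebraMap_int_eq,
        eq_intCast] at hz
      have hz0 : 0 < z := by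
        rw [← Int.cast_pos (R := ℝ), hz]
        positivity
      lift z to ℕ using hz0.le
      exact ⟨z, by rw [div_eq_iff hQ'.ne', mul_comm, ← hz, Int.cast_natCast]⟩
    obtain ⟨a, ha⟩ := exists_nat 0 (hS.subset hxS').1.1
    obtain ⟨b, hb⟩ := exists_nat 1 (hS.subset hxS').2.1
    refine ⟨(a, b), (hS.mem_latticePoints_iff hQ).2 (by simpa only [ha, hb]), ?_⟩
    ext i
    fin_cases i
    exacts [ha, hb]

theorem IsJordanRegion.tendsto_card_latticePoints {S : Set (ℝ × ℝ)} (hS : IsJordanRegion S) :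
    Tendsto (fun Q : ℕ => ((latticePoints S Q).card : ℝ) / (Q : ℝ) ^ 2) atTop
      (𝓝 (volume.real S)) := by
  let T : Set (Fin 2 → ℝ) := MeasurableEquiv.finTwoArrow ⁻¹' S
  have hvol : volume.real T = volume.real S :=
    (volume_preserving_finTwoArrow ℝ).measureReal_preimage hS.measurableSet.nullMeasurableSet
  have hbounded : Bornology.IsBounded T := by
    refine (Metric.isBounded_Icc (0 : Fin 2 → ℝ) 1).subset fun x hx => ?_
    obtain ⟨⟨_, _⟩, _, _⟩ := hS.subset (show (x 0, x 1) ∈ S from hx)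
    constructor <;> intro i <;> fin_cases i
    all_goals simp_all [le_of_lt]
  have hfrontier : volume (frontier T) = 0 := by
    rw [show frontier T = MeasurableEquiv.finTwoArrow ⁻¹' frontier S from
      ((Homeomorph.finTwoArrow (X := ℝ)).preimage_frontier S).symm,
      (volume_preserving_finTwoArrow ℝ).measure_preimage
        isClosed_frontier.measurableSet.nullMeasurableSet, hS.volume_frontier]
  have hlim := tendsto_card_div_pow_atTop_volume T hbounded
    (MeasurableEquiv.finTwoArrow.measurable hS.measurableSet) hfrontier
  rw [hvol, Fintype.card_fin] at hlim
  refine hlim.congr' ?_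
  filter_upwards [eventually_gt_atTop 0] with Q hQ
  rw [hS.card_latticePoints_eq hQ]

section Gcd

variable {S : Set (ℝ × ℝ)}

/-- The lattice points of `S` both of whose coordinates are divisible by `e`. -/
def multiplePoints (S : Set (ℝ × ℝ)) (e Q : ℕ) : Finset (ℕ × ℕ) :=
  (latticePoints S Q).filter fun v => e ∣ Nat.gcd v.1 v.2

theorem IsJordanRegion.card_multiplePoints (hS : IsJordanRegion S) {e Q : ℕ} (he : 0 < e)
    (hQ : 0 < Q) :
    (multiplePoints S e Q).card =
      (latticePoints ((fun p : ℝ × ℝ => (e : ℝ) • p) ⁻¹' S) Q).card := by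
  have key : ∀ v : ℕ × ℕ, e • v ∈ latticePoints S Q ↔
      v ∈ latticePoints ((fun p : ℝ × ℝ => (e : ℝ) • p) ⁻¹' S) Q := fun v => by
    rw [hS.mem_latticePoints_iff hQ, (hS.preimage_smul he).mem_latticePoints_iff hQ]
    simp only [Set.mem_preimage, Prod.smul_fst, Prod.smul_snd, Prod.smul_mk, smul_eq_mul,
      Nat.cast_mul, mul_div_assoc]
  refine (Finset.card_nbij' (e • ·) (fun v => (v.1 / e, v.2 / e)) ?_ ?_ ?_ ?_).symm
  · intro v hv
    refine Finset.mem_filter.2 ⟨(key v).2 hv, ?_⟩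
    exact Nat.dvd_gcd (dvd_mul_right e v.1) (dvd_mul_right e v.2)
  · intro v hv
    obtain ⟨hvS, hdvd⟩ := Finset.mem_filter.1 hv
    refine (key _).1 ?_
    rwa [Prod.smul_mk, smul_eq_mul, smul_eq_mul, Nat.mul_div_cancel' (Nat.dvd_gcd_iff.1 hdvd).1,
      Nat.mul_div_cancel' (Nat.dvd_gcd_iff.1 hdvd).2]
  · intro v _
    simp [he]
  · intro v hv
    obtain ⟨-, hdvd⟩ := Finset.mem_filter.1 hv
    exact Prod.ext (Nat.mul_div_cancel' (Nat.dvd_gcd_iff.1 hdvd).1)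
      (Nat.mul_div_cancel' (Nat.dvd_gcd_iff.1 hdvd).2)

theorem IsJordanRegion.tendsto_card_multiplePoints (hS : IsJordanRegion S) {e : ℕ} (he : 0 < e) :
    Tendsto (fun Q : ℕ => ((multiplePoints S e Q).card : ℝ) / (Q : ℝ) ^ 2) atTop
      (𝓝 (volume.real S / (e : ℝ) ^ 2)) := by
  rw [← volume_real_preimage_smul S (Nat.cast_ne_zero.2 he.ne')]
  refine (hS.preimage_smul he).tendsto_card_latticePoints.congr' ?_
  filter_upwards [eventually_gt_atTop 0] with Q hQ
  rw [hS.card_multiplePoints he hQ]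

theorem card_multiplePoints_le (S : Set (ℝ × ℝ)) (e Q : ℕ) :
    ((multiplePoints S e Q).card : ℝ) ≤ ((Q : ℝ) / e) ^ 2 := by
  have hsubset : multiplePoints S e Q ⊆
      ((Finset.Ioc 0 Q).filter (e ∣ ·)) ×ˢ ((Finset.Ioc 0 Q).filter (e ∣ ·)) := fun v hv => by
    simp only [multiplePoints, Finset.mem_filter, mem_latticePoints, Nat.dvd_gcd_iff] at hv
    simp only [Finset.mem_product, Finset.mem_filter, Finset.mem_Ioc]
    omega
  have hcard := Finset.card_le_card hsubset
  rw [Finset.card_product, Nat.Ioc_filter_dvd_card_eq_div] at hcard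
  calc ((multiplePoints S e Q).card : ℝ) ≤ ((Q / e : ℕ) : ℝ) * ((Q / e : ℕ) : ℝ) := by
        exact_mod_cast hcard
    _ ≤ (Q : ℝ) / e * ((Q : ℝ) / e) := by gcongr <;> exact Nat.cast_div_le
    _ = ((Q : ℝ) / e) ^ 2 := (sq _).symm

theorem sum_divisors_moebius (n : ℕ) :
    ∑ f ∈ n.divisors, (moebius f : ℝ) = if n = 1 then 1 else 0 := by
  have h := congrArg (fun F : ArithmeticFunction ℤ => F n)
    ArithmeticFunction.coe_zeta_mul_moebius
  simp only [ArithmeticFunction.coe_zeta_mul_apply, ArithmeticFunction.one_apply] at h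
  exact_mod_cast h

theorem sum_moebius_of_mul_dvd {g d Q : ℕ} (hg : 0 < g) (hgQ : g ≤ Q) (hd : 0 < d) :
    ∑ f ∈ Finset.Icc 1 Q, (if d * f ∣ g then (moebius f : ℝ) else 0) = if g = d then 1 else 0 := by
  by_cases hdg : d ∣ g
  · obtain ⟨n, rfl⟩ := hdg
    have hn : 0 < n := Nat.pos_of_mul_pos_left hg
    have hdivisors : (Finset.Icc 1 Q).filter (fun f => d * f ∣ d * n) = n.divisors := by
      ext f
      simp only [Finset.mem_filter, Finset.mem_Icc, Nat.mem_divisors, Nat.mul_dvd_mul_iff_left hd]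
      refine ⟨fun h => ⟨h.2, hn.ne'⟩, fun h => ⟨⟨Nat.pos_of_dvd_of_pos h.1 hn, ?_⟩, h.1⟩⟩
      exact (Nat.le_of_dvd hn h.1).trans ((Nat.le_mul_of_pos_left n hd).trans hgQ)
    rw [← Finset.sum_filter, hdivisors, sum_divisors_moebius]
    simp only [mul_eq_left₀ hd.ne']
  · rw [if_neg (by rintro rfl; exact hdg dvd_rfl)]
    exact Finset.sum_eq_zero fun f _ => if_neg fun h => hdg ((dvd_mul_right d f).trans h)

theorem tsum_moebius_div_sq : ∑' f : ℕ, (moebius f : ℝ) / (f : ℝ) ^ 2 = 6 / Real.pi ^ 2 := by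
  have hLSeries : LSeries (fun n => ((moebius n : ℤ) : ℂ)) 2 =
      ((∑' f : ℕ, (moebius f : ℝ) / (f : ℝ) ^ 2 : ℝ) : ℂ) := by
    rw [LSeries, Complex.ofReal_tsum]
    refine tsum_congr fun n => ?_
    rcases eq_or_ne n 0 with rfl | hn
    · simp
    · rw [LSeries.term_of_ne_zero hn]
      push_cast
      norm_num
  have hprod := ArithmeticFunction.LSeries_zeta_mul_Lseries_moebius (s := 2) (by norm_num)
  rw [ArithmeticFunction.LSeries_zeta_eq_riemannZeta (by norm_num), riemannZeta_two,
    hLSeries] at hprod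
  have hprod' : Real.pi ^ 2 / 6 * ∑' f : ℕ, (moebius f : ℝ) / (f : ℝ) ^ 2 = 1 := by
    exact_mod_cast hprod
  rw [← inv_div, ← eq_inv_of_mul_eq_one_right hprod']

theorem card_latticePoints_gcd_eq (S : Set (ℝ × ℝ)) {d : ℕ} (hd : 0 < d) (Q : ℕ) :
    (((latticePoints S Q).filter fun v => Nat.gcd v.1 v.2 = d).card : ℝ) =
      ∑' f : ℕ, (moebius f : ℝ) * ((multiplePoints S (d * f) Q).card : ℝ) := by
  have hcard : ∀ f : ℕ, (moebius f : ℝ) * ((multiplePoints S (d * f) Q).card : ℝ) =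
      ∑ v ∈ latticePoints S Q, if d * f ∣ Nat.gcd v.1 v.2 then (moebius f : ℝ) else 0 := fun f => by
    rw [multiplePoints, ← Finset.sum_filter, Finset.sum_const, nsmul_eq_mul, mul_comm]
  have gcd_bounds : ∀ v ∈ latticePoints S Q, 0 < Nat.gcd v.1 v.2 ∧ Nat.gcd v.1 v.2 ≤ Q :=
    fun v hv => by
      obtain ⟨⟨⟨hpos, hle⟩, -⟩, -⟩ := mem_latticePoints.1 hv
      exact ⟨Nat.gcd_pos_of_pos_left _ hpos, (Nat.gcd_le_left _ hpos).trans hle⟩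
  rw [tsum_eq_sum (s := Finset.Icc 1 Q) fun f hf => ?_, Finset.sum_congr rfl fun f _ => hcard f,
    Finset.sum_comm, Finset.card_filter, Nat.cast_sum]
  · refine Finset.sum_congr rfl fun v hv => ?_
    rw [sum_moebius_of_mul_dvd (gcd_bounds v hv).1 (gcd_bounds v hv).2 hd]
    push_cast
    rfl
  · rcases Nat.eq_zero_or_pos f with rfl | hf0
    · simp
    rw [hcard]
    refine Finset.sum_eq_zero fun v hv => if_neg fun hdvd => hf (Finset.mem_Icc.2 ⟨hf0, ?_⟩)
    exact (Nat.le_of_dvd (gcd_bounds v hv).1 (dvd_of_mul_left_dvd hdvd)).trans (gcd_bounds v hv).2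

theorem IsJordanRegion.tendsto_card_latticePoints_gcd (hS : IsJordanRegion S) {d : ℕ}
    (hd : 0 < d) :
    Tendsto (fun Q : ℕ => (((latticePoints S Q).filter fun v => Nat.gcd v.1 v.2 = d).card : ℝ) /
      (Q : ℝ) ^ 2) atTop (𝓝 (6 / Real.pi ^ 2 * volume.real S / (d : ℝ) ^ 2)) := by
  have hsum : ∑' f : ℕ, (moebius f : ℝ) * (volume.real S / ((d * f : ℕ) : ℝ) ^ 2) =
      6 / Real.pi ^ 2 * volume.real S / (d : ℝ) ^ 2 := by
    rw [← tsum_moebius_div_sq, mul_div_assoc, ← tsum_mul_right]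
    refine tsum_congr fun f => ?_
    push_cast
    ring
  have hlim : Tendsto (fun Q : ℕ => ∑' f : ℕ, (moebius f : ℝ) *
      (((multiplePoints S (d * f) Q).card : ℝ) / (Q : ℝ) ^ 2)) atTop
      (𝓝 (∑' f : ℕ, (moebius f : ℝ) * (volume.real S / ((d * f : ℕ) : ℝ) ^ 2))) := by
    refine tendsto_tsum_of_dominated_convergence (bound := fun f : ℕ => 1 / (f : ℝ) ^ 2)
      (Real.summable_one_div_nat_pow.2 one_lt_two) (fun f => ?_) ?_
    · rcases Nat.eq_zero_or_pos f with rfl | hf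
      · simp
      · exact (hS.tendsto_card_multiplePoints (Nat.mul_pos hd hf)).const_mul _
    · filter_upwards [eventually_gt_atTop 0] with Q hQ f
      rcases Nat.eq_zero_or_pos f with rfl | hf
      · simp
      have hmoebius : |(moebius f : ℝ)| ≤ 1 := by
        exact_mod_cast (ArithmeticFunction.abs_moebius_le_one (n := f))
      rw [norm_mul, Real.norm_eq_abs, Real.norm_of_nonneg (by positivity)]
      calc |(moebius f : ℝ)| * (((multiplePoints S (d * f) Q).card : ℝ) / (Q : ℝ) ^ 2)
          ≤ 1 * (((Q : ℝ) / ((d * f : ℕ) : ℝ)) ^ 2 / (Q : ℝ) ^ 2) := by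
            gcongr
            exact card_multiplePoints_le S (d * f) Q
        _ = 1 / ((d * f : ℕ) : ℝ) ^ 2 := by field_simp
        _ ≤ 1 / (f : ℝ) ^ 2 := by
            gcongr
            exact_mod_cast Nat.le_mul_of_pos_left f hd
  rw [hsum] at hlim
  refine hlim.congr fun Q => ?_
  simp only [card_latticePoints_gcd_eq S hd, ← mul_div_assoc, tsum_div_const]

/-- The number of residues `t` modulo `v.1` with `t * v.2 ≡ k`: the gcd of the coordinates of `v`
if it divides `k`, and `0` otherwise. -/
def gcdWeight (k : ℕ) (v : ℕ × ℕ) : ℕ := if Nat.gcd v.1 v.2 ∣ k then Nat.gcd v.1 v.2 else 0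

/-- The mean value `6 σ(k) / (π² k)` of `gcdWeight k` over the lattice. -/
def meanWeight (k : ℕ) : ℝ := 6 / Real.pi ^ 2 * ((sigma 1 k : ℝ) / k)

theorem meanWeight_nonneg (k : ℕ) : 0 ≤ meanWeight k := by
  unfold meanWeight
  positivity

theorem sigma_one_div_self (k : ℕ) :
    (sigma 1 k : ℝ) / k = ∑ d ∈ k.divisors, 1 / (d : ℝ) := by
  rw [ArithmeticFunction.sigma_one_apply, ← Nat.sum_div_divisors k (fun d => 1 / (d : ℝ)),
    Nat.cast_sum, Finset.sum_div]
  refine Finset.sum_congr rfl fun d hd => ?_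
  rw [Nat.cast_div (Nat.dvd_of_mem_divisors hd)
    (Nat.cast_ne_zero.2 (Nat.pos_of_mem_divisors hd).ne'), one_div_div]

theorem sum_gcdWeight_eq {k : ℕ} (hk : 0 < k) (s : Finset (ℕ × ℕ)) :
    (∑ v ∈ s, (gcdWeight k v : ℝ)) =
      ∑ d ∈ k.divisors, (d : ℝ) * ((s.filter fun v => Nat.gcd v.1 v.2 = d).card : ℝ) := by
  have hweight : ∀ v : ℕ × ℕ, (gcdWeight k v : ℝ) =
      ∑ d ∈ k.divisors, if Nat.gcd v.1 v.2 = d then (d : ℝ) else 0 := fun v => by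
    rw [Finset.sum_ite_eq, gcdWeight]
    simp [Nat.mem_divisors, hk.ne']
  simp only [hweight]
  rw [Finset.sum_comm]
  refine Finset.sum_congr rfl fun d _ => ?_
  rw [← Finset.sum_filter, Finset.sum_const, nsmul_eq_mul, mul_comm]

theorem IsJordanRegion.tendsto_sum_gcdWeight (hS : IsJordanRegion S) {k : ℕ} (hk : 0 < k) :
    Tendsto (fun Q : ℕ => (∑ v ∈ latticePoints S Q, (gcdWeight k v : ℝ)) / (Q : ℝ) ^ 2) atTop
      (𝓝 (meanWeight k * volume.real S)) := by
  have hmean : meanWeight k * volume.real S =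
      ∑ d ∈ k.divisors, (d : ℝ) * (6 / Real.pi ^ 2 * volume.real S / (d : ℝ) ^ 2) := by
    rw [meanWeight, sigma_one_div_self, Finset.mul_sum, Finset.sum_mul]
    refine Finset.sum_congr rfl fun d hd => ?_
    have hd0 : (d : ℝ) ≠ 0 := Nat.cast_ne_zero.2 (Nat.pos_of_mem_divisors hd).ne'
    field_simp
  simp only [hmean, sum_gcdWeight_eq hk, Finset.sum_div, mul_div_assoc (_ : ℝ) (Nat.cast _)]
  exact tendsto_finsetSum _ fun d hd =>
    (hS.tendsto_card_latticePoints_gcd (Nat.pos_of_mem_divisors hd)).const_mul _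

end Gcd

section Regions

/-- The trapezoid `X₁ < x ≤ X₂`, `b₁ x < y < b₂ x`. -/
def trapezoid (X₁ X₂ b₁ b₂ : ℝ) : Set (ℝ × ℝ) :=
  regionBetween (fun x => b₁ * x) (fun x => b₂ * x) (Set.Ioc X₁ X₂)

theorem mem_trapezoid {X₁ X₂ b₁ b₂ : ℝ} {p : ℝ × ℝ} :
    p ∈ trapezoid X₁ X₂ b₁ b₂ ↔ (X₁ < p.1 ∧ p.1 ≤ X₂) ∧ b₁ * p.1 < p.2 ∧ p.2 < b₂ * p.1 :=
  Iff.rfl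

theorem convex_trapezoid (X₁ X₂ b₁ b₂ : ℝ) : Convex ℝ (trapezoid X₁ X₂ b₁ b₂) := by
  have heq : trapezoid X₁ X₂ b₁ b₂ = LinearMap.fst ℝ ℝ ℝ ⁻¹' Set.Ioc X₁ X₂ ∩
      ((LinearMap.snd ℝ ℝ ℝ - b₁ • LinearMap.fst ℝ ℝ ℝ) ⁻¹' Set.Ioi 0 ∩
        (b₂ • LinearMap.fst ℝ ℝ ℝ - LinearMap.snd ℝ ℝ ℝ) ⁻¹' Set.Ioi 0) := by
    ext p
    simp [mem_trapezoid]
  rw [heq]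
  exact ((convex_Ioc X₁ X₂).linear_preimage _).inter
    (((convex_Ioi 0).linear_preimage _).inter ((convex_Ioi 0).linear_preimage _))

theorem isJordanRegion_trapezoid {X₁ X₂ b₁ b₂ : ℝ} (hX₁ : 0 ≤ X₁) (hX₂ : X₂ ≤ 1) (hb₁ : 0 ≤ b₁)
    (hb₂ : b₂ ≤ 1) : IsJordanRegion (trapezoid X₁ X₂ b₁ b₂) := by
  refine .of_convex (fun p hp => ?_)
    (measurableSet_regionBetween (by fun_prop) (by fun_prop) measurableSet_Ioc)
    (convex_trapezoid X₁ X₂ b₁ b₂)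
  obtain ⟨⟨hleft, hright⟩, hbelow, habove⟩ := mem_trapezoid.1 hp
  have hp0 : 0 < p.1 := hX₁.trans_lt hleft
  exact ⟨⟨hp0, hright.trans hX₂⟩, (mul_nonneg hb₁ hp0.le).trans_lt hbelow,
    habove.le.trans (mul_le_one₀ hb₂ hp0.le (hright.trans hX₂))⟩

theorem volume_real_trapezoid {X₁ X₂ b₁ b₂ : ℝ} (hX₁ : 0 ≤ X₁) (hX : X₁ ≤ X₂) (hb : b₁ ≤ b₂) :
    volume.real (trapezoid X₁ X₂ b₁ b₂) = (b₂ - b₁) * (X₂ ^ 2 - X₁ ^ 2) / 2 := by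
  have hint : ∀ b : ℝ, IntegrableOn (fun x : ℝ => b * x) (Set.Ioc X₁ X₂) :=
    fun b => Continuous.integrableOn_Ioc (by fun_prop)
  have hintegral : ∫ x in Set.Ioc X₁ X₂, ((fun x => b₂ * x) - fun x => b₁ * x) x =
      (b₂ - b₁) * (X₂ ^ 2 - X₁ ^ 2) / 2 := by
    simp only [Pi.sub_apply, ← sub_mul]
    rw [← intervalIntegral.integral_of_le hX, intervalIntegral.integral_const_mul, integral_id]
    ring
  rw [trapezoid, measureReal_def, Measure.volume_eq_prod,
    volume_regionBetween_eq_integral (hint b₁) (hint b₂) measurableSet_Ioc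
      (fun x hx => mul_le_mul_of_nonneg_right hb (hX₁.trans hx.1.le)), hintegral,
    ENNReal.toReal_ofReal]
  have hsq : 0 ≤ X₂ ^ 2 - X₁ ^ 2 := sub_nonneg.2 (pow_le_pow_left₀ hX₁ hX 2)
  exact div_nonneg (mul_nonneg (sub_nonneg.2 hb) hsq) zero_le_two

/-- The part `x y ≥ c` of the unit square. -/
def aboveHyperbola (c : ℝ) : Set (ℝ × ℝ) :=
  {p ∈ Set.Ioc 0 1 ×ˢ Set.Ioc 0 1 | c ≤ p.1 * p.2}

/-- The area of `aboveHyperbola c`, for `0 < c ≤ 1`. -/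
def hyperbolaArea (c : ℝ) : ℝ := 1 - c + c * Real.log c

theorem measurableSet_aboveHyperbola (c : ℝ) : MeasurableSet (aboveHyperbola c) :=
  (measurableSet_Ioc.prod measurableSet_Ioc).inter
    (measurableSet_le measurable_const (measurable_fst.mul measurable_snd))

theorem convex_aboveHyperbola {c : ℝ} (hc : 0 ≤ c) : Convex ℝ (aboveHyperbola c) := by
  have heq : aboveHyperbola c = Set.Ioc 0 1 ×ˢ Set.Ioc 0 1 ∩
      {p : ℝ × ℝ | p.1 ∈ Set.Ioi 0 ∧ c • p.1 ^ (-1 : ℤ) ≤ p.2} := by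
    ext p
    refine and_congr_right fun hp => ?_
    have hp0 : 0 < p.1 := hp.1.1
    simp only [Set.mem_ofPred_eq, Set.mem_Ioi, hp0, true_and, zpow_neg_one, smul_eq_mul,
      ← div_eq_mul_inv, div_le_iff₀ hp0, mul_comm]
  rw [heq]
  exact ((convex_Ioc 0 1).prod (convex_Ioc 0 1)).inter
    ((convexOn_zpow (-1)).smul hc).convex_epigraph

theorem isJordanRegion_aboveHyperbola {c : ℝ} (hc : 0 ≤ c) : IsJordanRegion (aboveHyperbola c) :=
  .of_convex (fun _ hp => hp.1) (measurableSet_aboveHyperbola c) (convex_aboveHyperbola hc)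

theorem volume_section_aboveHyperbola {c : ℝ} (hc : 0 < c) (x : ℝ) :
    volume (Prod.mk x ⁻¹' aboveHyperbola c) =
      (Set.Ioc c 1).indicator (fun x => ENNReal.ofReal (1 - c / x)) x := by
  have mem_section : ∀ y, y ∈ Prod.mk x ⁻¹' aboveHyperbola c ↔
      (x ∈ Set.Ioc (0 : ℝ) 1 ∧ y ∈ Set.Ioc (0 : ℝ) 1) ∧ c ≤ x * y := fun y => Iff.rfl
  by_cases hx : x ∈ Set.Ioc (0 : ℝ) 1
  · have hsection : Prod.mk x ⁻¹' aboveHyperbola c = Set.Icc (c / x) 1 := by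
      ext y
      rw [mem_section, Set.mem_Icc, div_le_iff₀' hx.1]
      exact ⟨fun h => ⟨h.2, h.1.2.2⟩,
        fun h => ⟨⟨hx, pos_of_mul_pos_right (hc.trans_le h.1) hx.1.le, h.2⟩, h.1⟩⟩
    rw [hsection, Real.volume_Icc]
    by_cases hcx : c < x
    · rw [Set.indicator_of_mem (Set.mem_Ioc.2 ⟨hcx, hx.2⟩)]
    · rw [Set.indicator_of_notMem fun h => hcx h.1, ENNReal.ofReal_eq_zero, sub_nonpos,
        one_le_div hx.1]
      exact not_lt.1 hcx
  · rw [Set.indicator_of_notMem fun h => hx ⟨hc.trans h.1, h.2⟩,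
      Set.eq_empty_of_forall_notMem fun y hy => hx ((mem_section y).1 hy).1.1, measure_empty]

theorem volume_real_aboveHyperbola {c : ℝ} (hc : 0 < c) (hc1 : c ≤ 1) :
    volume.real (aboveHyperbola c) = hyperbolaArea c := by
  have hcont : ContinuousOn (fun x : ℝ => 1 - c / x) (Set.Icc c 1) :=
    continuousOn_const.sub (continuousOn_const.div continuousOn_id fun x hx =>
      (hc.trans_le hx.1).ne')
  have hnonneg : 0 ≤ᵐ[volume.restrict (Set.Ioc c 1)] fun x => 1 - c / x := by
    filter_upwards [ae_restrict_mem measurableSet_Ioc] with x hx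
    exact sub_nonneg.2 ((div_le_one (hc.trans hx.1)).2 hx.1.le)
  have hinv : IntervalIntegrable (fun x : ℝ => c * x⁻¹) volume c 1 :=
    (intervalIntegral.intervalIntegrable_inv (fun x hx => ne_of_gt (hc.trans_le
      (Set.uIcc_of_le hc1 ▸ hx).1)) continuousOn_id).const_mul c
  have hintegral : ∫ x in Set.Ioc c 1, (1 - c / x) = hyperbolaArea c := by
    simp only [← intervalIntegral.integral_of_le hc1, div_eq_mul_inv]
    rw [intervalIntegral.integral_sub intervalIntegrable_const hinv,
      intervalIntegral.integral_const_mul, integral_inv_of_pos hc one_pos, hyperbolaArea]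
    simp
  rw [measureReal_def, Measure.volume_eq_prod,
    Measure.prod_apply (measurableSet_aboveHyperbola c),
    lintegral_congr (volume_section_aboveHyperbola hc), lintegral_indicator measurableSet_Ioc,
    ← ofReal_integral_eq_lintegral_ofReal (hcont.integrableOn_Icc.mono_set Set.Ioc_subset_Icc_self)
      hnonneg, hintegral, ENNReal.toReal_ofReal]
  exact hintegral ▸ integral_nonneg_of_ae hnonneg

end Regions

section Fibers

theorem mem_indices {Q : ℕ} {i : ℕ × ℕ} : i ∈ indices Q ↔ 1 ≤ i.1 ∧ i.1 < i.2 ∧ i.2 ≤ Q := by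
  simp only [indices, Finset.mem_filter, Finset.mem_product, Finset.mem_Icc]
  omega

open scoped Classical in
/-- The pairs of entries `p / q`, `p' / q'` of `M(Q)` in `I` with `p q' - p' q = k` and
`q q' ≥ c Q²`. The last condition restricts their distance `k / (q q')`. -/
def detPairs (I : Set ℝ) (Q k : ℕ) (c : ℝ) : Finset ((ℕ × ℕ) × (ℕ × ℕ)) :=
  (indices Q ×ˢ indices Q).filter fun ij =>
    point ij.1 ∈ I ∧ point ij.2 ∈ I ∧ ij.1.1 * ij.2.2 = ij.2.1 * ij.1.2 + k ∧
      c * (Q : ℝ) ^ 2 ≤ (ij.1.2 : ℝ) * ij.2.2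

theorem mem_detPairs {I : Set ℝ} {Q k : ℕ} {c : ℝ} {ij : (ℕ × ℕ) × (ℕ × ℕ)} :
    ij ∈ detPairs I Q k c ↔ (ij.1 ∈ indices Q ∧ ij.2 ∈ indices Q) ∧
      point ij.1 ∈ I ∧ point ij.2 ∈ I ∧ ij.1.1 * ij.2.2 = ij.2.1 * ij.1.2 + k ∧
      c * (Q : ℝ) ^ 2 ≤ (ij.1.2 : ℝ) * ij.2.2 := by
  simp [detPairs]

theorem card_filter_mul_modEq_le {q : ℕ} (hq : 0 < q) (a k : ℕ) :
    ((Finset.range q).filter fun r => r * a ≡ k [MOD q]).card ≤ gcdWeight k (q, a) := by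
  set F := (Finset.range q).filter fun r => r * a ≡ k [MOD q]
  set m := q / Nat.gcd q a
  rcases F.eq_empty_or_nonempty with hempty | ⟨r₀, hr₀⟩
  · simp [hempty]
  have hgcd : Nat.gcd q a ∣ k :=
    ((Finset.mem_filter.1 hr₀).2.dvd_iff (Nat.gcd_dvd_left q a)).1
      ((Nat.gcd_dvd_right q a).mul_left r₀)
  have hm : m * Nat.gcd q a = q := Nat.div_mul_cancel (Nat.gcd_dvd_left q a)
  rw [gcdWeight, if_pos hgcd, ← Finset.card_range (Nat.gcd q a)]
  refine Finset.card_le_card_of_injOn (· / m) (fun r hr => ?_) fun r hr s hs hrs => ?_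
  · refine Finset.mem_coe.2 (Finset.mem_range.2 (Nat.div_lt_of_lt_mul ?_))
    rw [hm]
    exact Finset.mem_range.1 (Finset.mem_filter.1 hr).1
  · have hmod : r ≡ s [MOD m] := Nat.ModEq.cancel_right_div_gcd hq
      ((Finset.mem_filter.1 hr).2.trans (Finset.mem_filter.1 hs).2.symm)
    rw [← Nat.div_add_mod r m, ← Nat.div_add_mod s m, hmod, show r / m = s / m from hrs]

theorem card_detPairs_fiber_le (I : Set ℝ) (Q k : ℕ) (c : ℝ) {v : ℕ × ℕ} (hv : 0 < v.1) :
    ((detPairs I Q k c).filter fun ij => (ij.1.2, ij.2.2) = v).card ≤ gcdWeight k v := by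
  obtain ⟨q, q'⟩ := v
  refine le_trans ?_ (card_filter_mul_modEq_le hv q' k)
  have det_eq : ∀ ij ∈ (detPairs I Q k c).filter fun ij => (ij.1.2, ij.2.2) = (q, q'),
      ij.1.1 * q' = ij.2.1 * q + k ∧ ij.1.1 < q ∧ ij.1.2 = q ∧ ij.2.2 = q' := fun ij hij => by
    rw [Finset.mem_filter, mem_detPairs, mem_indices, Prod.mk.injEq] at hij
    obtain ⟨⟨⟨hi, -⟩, -, -, hdet, -⟩, rfl, rfl⟩ := hij
    exact ⟨hdet, hi.2.1, rfl, rfl⟩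
  refine Finset.card_le_card_of_injOn (fun ij => ij.1.1) (fun ij hij => ?_)
    fun ij hij ij' hij' h => ?_
  · obtain ⟨hdet, hlt, -⟩ := det_eq ij hij
    refine Finset.mem_coe.2 (Finset.mem_filter.2 ⟨Finset.mem_range.2 hlt, ?_⟩)
    rw [hdet]
    exact Nat.modEq_iff_dvd.2 ⟨-ij.2.1, by push_cast; ring⟩
  · obtain ⟨hdet, -, hq, hq'⟩ := det_eq ij hij
    obtain ⟨hdet', -, hr, hr'⟩ := det_eq ij' hij'
    have hp : ij.1.1 = ij'.1.1 := h
    have hp' : ij.2.1 = ij'.2.1 := Nat.eq_of_mul_eq_mul_right hv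
      (Nat.add_right_cancel (hdet.symm.trans (hp ▸ hdet')))
    exact Prod.ext (Prod.ext hp (hq.trans hr.symm)) (Prod.ext hp' (hq'.trans hr'.symm))

theorem card_detPairs_le (I : Set ℝ) (Q k : ℕ) (c : ℝ) :
    (detPairs I Q k c).card ≤ ∑ v ∈ latticePoints (aboveHyperbola c) Q, gcdWeight k v := by
  rw [Finset.card_eq_sum_card_fiberwise (f := fun ij => (ij.1.2, ij.2.2))
    (t := latticePoints (aboveHyperbola c) Q)]
  · exact Finset.sum_le_sum fun v hv =>
      card_detPairs_fiber_le I Q k c (mem_latticePoints.1 hv).1.1.1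
  · intro ij hij
    obtain ⟨⟨hi, hj⟩, -, -, -, hlarge⟩ := mem_detPairs.1 hij
    rw [mem_indices] at hi hj
    have hi' : 1 ≤ ij.1.2 ∧ ij.1.2 ≤ Q := by omega
    have hj' : 1 ≤ ij.2.2 ∧ ij.2.2 ≤ Q := by omega
    have hQ : (0 : ℝ) < Q := Nat.cast_pos.2 (hi'.1.trans hi'.2)
    have mem_Ioc : ∀ a : ℕ, 1 ≤ a ∧ a ≤ Q → (a : ℝ) / Q ∈ Set.Ioc (0 : ℝ) 1 := fun a ha =>
      ⟨div_pos (Nat.cast_pos.2 ha.1) hQ, (div_le_one hQ).2 (Nat.cast_le.2 ha.2)⟩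
    refine Finset.mem_coe.2 (mem_latticePoints.2 ⟨⟨hi', hj'⟩, ⟨mem_Ioc _ hi', mem_Ioc _ hj'⟩, ?_⟩)
    rwa [div_mul_div_comm, ← sq, le_div_iff₀ (by positivity)]

end Fibers

section LiminfGE

variable {ι κ : Type*} {l : Filter ι} {f g : ι → ℝ} {L M : ℝ}

/-- `L ≤ liminf f`, in a form that does not presuppose that `f` is bounded. -/
def LiminfGE (l : Filter ι) (f : ι → ℝ) (L : ℝ) : Prop := ∀ L' < L, ∀ᶠ x in l, L' < f x

namespace LiminfGE

theorem mono (hf : LiminfGE l f L) (hfg : ∀ᶠ x in l, f x ≤ g x) : LiminfGE l g L :=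
  fun L' hL' => (hf L' hL').mp (hfg.mono fun _ hle hlt => hlt.trans_le hle)

theorem anti (hf : LiminfGE l f L) (hML : M ≤ L) : LiminfGE l f M :=
  fun L' hL' => hf L' (hL'.trans_le hML)

theorem of_tendsto (hf : Tendsto f l (𝓝 L)) : LiminfGE l f L :=
  fun _ hL' => hf.eventually_const_lt hL'

theorem of_nonpos (hf : ∀ x, 0 ≤ f x) (hL : L ≤ 0) : LiminfGE l f L :=
  fun _ hL' => Eventually.of_forall fun x => (hL'.trans_le hL).trans_le (hf x)

theorem add (hf : LiminfGE l f L) (hg : LiminfGE l g M) :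
    LiminfGE l (fun x => f x + g x) (L + M) := by
  intro L' hL'
  filter_upwards [hf (L - (L + M - L') / 2) (by linarith), hg (M - (L + M - L') / 2) (by linarith)]
    with x hfx hgx
  linarith

theorem sum {s : Finset κ} {F : κ → ι → ℝ} {a : κ → ℝ} (h : ∀ y ∈ s, LiminfGE l (F y) (a y)) :
    LiminfGE l (fun x => ∑ y ∈ s, F y x) (∑ y ∈ s, a y) := by
  classical
  induction s using Finset.induction_on with
  | empty => exact of_tendsto tendsto_const_nhds
  | insert y s hy ih =>
    simp only [Finset.sum_insert hy]
    exact (h y (Finset.mem_insert_self y s)).add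
      (ih fun z hz => h z (Finset.mem_insert_of_mem hz))

theorem closure {m : Filter κ} [m.NeBot] {a : κ → ℝ} (ha : Tendsto a m (𝓝 L))
    (h : ∀ᶠ y in m, LiminfGE l f (a y)) : LiminfGE l f L := by
  intro L' hL'
  obtain ⟨y, hlt, hy⟩ := ((ha.eventually_const_lt hL').and h).exists
  exact hy L' hlt

theorem tendsto (hf : LiminfGE l f L) (hf' : LiminfGE l (fun x => -f x) (-L)) :
    Tendsto f l (𝓝 L) :=
  tendsto_order.2 ⟨hf, fun U hU => (hf' (-U) (neg_lt_neg hU)).mono fun _ => neg_lt_neg_iff.1⟩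

end LiminfGE

end LiminfGE

section Lifts

/- Since `x m + y n = 1`, the solutions of the first two equations are `p = P m - a y`,
`q = R m - D y`, `p' = P n + a x`, `q' = R n + D x` with arbitrary `P` and `R`. Their determinant is
`P D - R a`, which Bézout's identity makes equal to `k`. -/
theorem exists_det_eq_of_gcd_dvd {m n D a k : ℤ} (hmn : IsCoprime m n)
    (hk : (Int.gcd D a : ℤ) ∣ k) :
    ∃ p q p' q' : ℤ, q' * m = q * n + D ∧ p' * m = p * n + a ∧ p * q' = p' * q + k := by
  obtain ⟨x, y, hxy⟩ := hmn
  obtain ⟨l, rfl⟩ := hk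
  have bezout := Int.gcd_eq_gcd_ab D a
  refine ⟨l * D.gcdA a * m - a * y, -(l * D.gcdB a) * m - D * y,
    l * D.gcdA a * n + a * x, -(l * D.gcdB a) * n + D * x, ?_, ?_, ?_⟩
  · linear_combination D * hxy
  · linear_combination a * hxy
  · linear_combination (D * (l * D.gcdA a) + a * (l * D.gcdB a)) * hxy - l * bezout

theorem sub_sub_one_le_card_Icc_ceil_floor (x y : ℝ) :
    y - x - 1 ≤ ((Finset.Icc ⌈x⌉ ⌊y⌋).card : ℝ) := by
  have htoNat : ((⌊y⌋ + 1 - ⌈x⌉ : ℤ) : ℝ) ≤ (((⌊y⌋ + 1 - ⌈x⌉).toNat : ℤ) : ℝ) :=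
    Int.cast_le.2 (Int.self_le_toNat _)
  rw [Int.card_Icc]
  push_cast at htoNat ⊢
  linarith [Int.ceil_lt_add_one x, Int.lt_floor_add_one y]

/-- `IsLift m n k (D, a) ((p, q), (p', q'))`: the pair of fractions `p / q`, `p' / q'` has
determinant `p q' - p' q = k`, and the linear map `(p, q, p', q') ↦ (q' m - q n, p' m - p n)` sends
it to `(D, a)`. -/
structure IsLift (m n k : ℕ) (v : ℕ × ℕ) (ij : (ℕ × ℕ) × (ℕ × ℕ)) : Prop where
  den_eq : ij.2.2 * m = ij.1.2 * n + v.1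
  num_eq : ij.2.1 * m = ij.1.1 * n + v.2
  det_eq : ij.1.1 * ij.2.2 = ij.2.1 * ij.1.2 + k

theorem exists_isLift_of_int {m n k D a : ℕ} (hm : 0 < m) (hD : 0 < D) {p q p' q' : ℤ}
    (hq : 0 ≤ q) (hden : q' * m = q * n + D) (hnum : p' * m = p * n + a)
    (hdet : p * q' = p' * q + k) : ∃ ij, IsLift m n k (D, a) ij ∧ (ij.1.2 : ℤ) = q := by
  have hmZ : (0 : ℤ) < m := Int.natCast_pos.2 hm
  have hpD : p * D = a * q + k * m := by linear_combination -p * hden + q * hnum + m * hdet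
  have hp : 0 ≤ p := nonneg_of_mul_nonneg_left (hpD ▸ by positivity) (Int.natCast_pos.2 hD)
  have hp' : 0 ≤ p' := nonneg_of_mul_nonneg_left (hnum ▸ by positivity) hmZ
  have hq' : 0 ≤ q' := nonneg_of_mul_nonneg_left (hden ▸ by positivity) hmZ
  lift p to ℕ using hp
  lift q to ℕ using hq
  lift p' to ℕ using hp'
  lift q' to ℕ using hq'
  exact ⟨((p, q), (p', q')), ⟨mod_cast hden, mod_cast hnum, mod_cast hdet⟩, rfl⟩

theorem exists_progression_isLift {m n k : ℕ} {v : ℕ × ℕ} (hm : 0 < m) (hmn : m.Coprime n)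
    (hv : 0 < v.1) (hk : v.1.gcd v.2 ∣ k) :
    ∃ q₀ : ℤ, ∀ t : ℤ, 0 ≤ q₀ + t * (m * (v.1 / v.1.gcd v.2 : ℕ)) →
      ∃ ij, IsLift m n k v ij ∧ (ij.1.2 : ℤ) = q₀ + t * (m * (v.1 / v.1.gcd v.2 : ℕ)) := by
  obtain ⟨D, a⟩ := v
  obtain ⟨p, q, p', q', hden, hnum, hdet⟩ := exists_det_eq_of_gcd_dvd (m := m) (n := n) (D := D)
    (a := a) (k := k) (Nat.isCoprime_iff_coprime.2 hmn) (Int.natCast_dvd_natCast.2 hk)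
  set D₁ := D / D.gcd a
  set a₁ := a / D.gcd a
  have hD₁ : (D.gcd a : ℤ) * D₁ = D := mod_cast Nat.mul_div_cancel' (Nat.gcd_dvd_left D a)
  have ha₁ : (D.gcd a : ℤ) * a₁ = a := mod_cast Nat.mul_div_cancel' (Nat.gcd_dvd_right D a)
  have hcross : (a₁ : ℤ) * D = D₁ * a := by rw [← hD₁, ← ha₁]; ring
  refine ⟨q, fun t ht => exists_isLift_of_int (p := p + t * (m * a₁)) (p' := p' + t * (n * a₁))
    (q' := q' + t * (n * D₁)) hm hv ht ?_ ?_ ?_⟩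
  · linear_combination hden
  · linear_combination hnum
  · linear_combination hdet + t * a₁ * hden - t * D₁ * hnum + t * hcross

theorem exists_finset_isLift {m n k : ℕ} {v : ℕ × ℕ} (hm : 0 < m) (hmn : m.Coprime n)
    (hv : 0 < v.1) (hk : v.1.gcd v.2 ∣ k) {x : ℝ} (hx : 0 ≤ x) (y : ℝ) :
    ∃ F : Finset ((ℕ × ℕ) × (ℕ × ℕ)), (y - x) / (m * v.1) * v.1.gcd v.2 - 1 ≤ (F.card : ℝ) ∧
      ∀ ij ∈ F, IsLift m n k v ij ∧ x ≤ ij.1.2 ∧ (ij.1.2 : ℝ) ≤ y := by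
  obtain ⟨q₀, hq₀⟩ := exists_progression_isLift hm hmn hv hk
  have hD₁ : 0 < v.1 / v.1.gcd v.2 := Nat.div_gcd_pos_of_pos_left _ hv
  set s : ℕ := m * (v.1 / v.1.gcd v.2) with hs
  have hstep : (0 : ℝ) < s := Nat.cast_pos.2 (Nat.mul_pos hm hD₁)
  have hlift : ∀ t ∈ Finset.Icc ⌈(x - q₀) / s⌉ ⌊(y - q₀) / s⌋, ∃ ij,
      IsLift m n k v ij ∧ (ij.1.2 : ℤ) = q₀ + t * s ∧ x ≤ ij.1.2 ∧ (ij.1.2 : ℝ) ≤ y := by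
    intro t ht
    rw [Finset.mem_Icc, Int.ceil_le, Int.le_floor, div_le_iff₀ hstep, le_div_iff₀ hstep] at ht
    have hxq : x ≤ (q₀ + t * s : ℤ) := by push_cast; linarith
    have hqy : (q₀ + t * s : ℤ) ≤ y := by push_cast; linarith
    obtain ⟨ij, hij, hq⟩ := hq₀ t (by rw [hs] at hxq; exact_mod_cast hx.trans hxq)
    rw [← Nat.cast_mul, ← hs] at hq
    rw [← hq, Int.cast_natCast] at hxq hqy
    exact ⟨ij, hij, hq, hxq, hqy⟩
  choose! lift hisLift hq hmem using hlift
  refine ⟨(Finset.Icc ⌈(x - q₀) / s⌉ ⌊(y - q₀) / s⌋).image lift, ?_, ?_⟩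
  · rw [Finset.card_image_of_injOn fun t ht u hu htu => ?_]
    · refine le_trans (le_of_eq ?_) (sub_sub_one_le_card_Icc_ceil_floor _ _)
      have hgs : (s : ℝ) * v.1.gcd v.2 = m * v.1 := by
        rw [hs, ← Nat.cast_mul, mul_assoc, Nat.div_mul_cancel (Nat.gcd_dvd_left _ _), Nat.cast_mul]
      have hg : (v.1.gcd v.2 : ℝ) ≠ 0 := Nat.cast_ne_zero.2 (Nat.gcd_pos_of_pos_left _ hv).ne'
      rw [← hgs, ← sub_div, sub_sub_sub_cancel_right, ← div_div, div_mul_cancel₀ _ hg]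
    · have heq : q₀ + t * s = q₀ + u * s := by rw [← hq t ht, ← hq u hu, htu]
      exact mul_right_cancel₀ (by exact_mod_cast hstep.ne') (add_left_cancel heq)
  · simp only [Finset.forall_mem_image]
    exact fun t ht => ⟨hisLift t ht, hmem t ht⟩

theorem exists_finset_isLift_gcdWeight_le {m n : ℕ} {v : ℕ × ℕ} (hm : 0 < m) (hmn : m.Coprime n)
    (hv : 0 < v.1) (k : ℕ) {θ₁ θ₂ : ℝ} (hθ₁ : 0 < θ₁) (hθ₂ : 0 < θ₂) :
    ∃ F : Finset ((ℕ × ℕ) × (ℕ × ℕ)), (1 / θ₁ - 1 / θ₂ - 1) * gcdWeight k v ≤ (F.card : ℝ) ∧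
      ∀ ij ∈ F, IsLift m n k v ij ∧ θ₁ * ij.1.2 ≤ m * v.1 ∧ (m * v.1 : ℝ) ≤ θ₂ * ij.1.2 := by
  by_cases hk : v.1.gcd v.2 ∣ k
  · obtain ⟨F, hcard, hF⟩ := exists_finset_isLift hm hmn hv hk (x := m * v.1 / θ₂)
      (by positivity) (m * v.1 / θ₁)
    refine ⟨F, le_trans ?_ hcard, fun ij hij => ?_⟩
    · have hg : (1 : ℝ) ≤ v.1.gcd v.2 := Nat.one_le_cast.2 (Nat.gcd_pos_of_pos_left _ hv)
      have hlen : (m * v.1 / θ₁ - m * v.1 / θ₂) / (m * v.1 : ℝ) = 1 / θ₁ - 1 / θ₂ := by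
        have : (m * v.1 : ℝ) ≠ 0 := by positivity
        field_simp
      rw [gcdWeight, if_pos hk, hlen]
      linarith
    · obtain ⟨hlift, hleft, hright⟩ := hF ij hij
      rw [div_le_iff₀' hθ₂] at hleft
      rw [le_div_iff₀' hθ₁] at hright
      exact ⟨hlift, hright, hleft⟩
  · exact ⟨∅, by simp [gcdWeight, hk], by simp⟩

namespace IsLift

variable {m n k : ℕ} {v : ℕ × ℕ} {ij : (ℕ × ℕ) × (ℕ × ℕ)}

theorem eq_sub (h : IsLift m n k v ij) :
    (ij.2.2 * m - ij.1.2 * n, ij.2.1 * m - ij.1.1 * n) = v := by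
  rw [h.den_eq, h.num_eq, Nat.add_sub_cancel_left, Nat.add_sub_cancel_left]

theorem slope_eq (h : IsLift m n k v ij) (hm : 0 < m) (hq : 0 < ij.1.2) :
    (ij.2.2 : ℝ) / ij.1.2 = n / m + m * v.1 / ij.1.2 / m ^ 2 := by
  have hden : (ij.2.2 * m : ℝ) = ij.1.2 * n + v.1 := mod_cast h.den_eq
  have hm₀ : (m : ℝ) ≠ 0 := by positivity
  have hq₀ : (ij.1.2 : ℝ) ≠ 0 := by positivity
  field_simp
  linear_combination hden

theorem point_fst_eq (h : IsLift m n k v ij) (hv : 0 < v.1) (hq : 0 < ij.1.2) :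
    point ij.1 = v.2 / v.1 + k * m / (ij.1.2 * v.1) := by
  have hden : (ij.2.2 * m : ℝ) = ij.1.2 * n + v.1 := mod_cast h.den_eq
  have hnum : (ij.2.1 * m : ℝ) = ij.1.1 * n + v.2 := mod_cast h.num_eq
  have hdet : (ij.1.1 * ij.2.2 : ℝ) = ij.2.1 * ij.1.2 + k := mod_cast h.det_eq
  have hD₀ : (v.1 : ℝ) ≠ 0 := by positivity
  have hq₀ : (ij.1.2 : ℝ) ≠ 0 := by positivity
  rw [point]
  field_simp
  linear_combination -(ij.1.1 : ℝ) * hden + ij.1.2 * hnum + m * hdet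

theorem point_snd_eq (h : IsLift m n k v ij) (hv : 0 < v.1) (hq' : 0 < ij.2.2) :
    point ij.2 = v.2 / v.1 + k * n / (ij.2.2 * v.1) := by
  have hden : (ij.2.2 * m : ℝ) = ij.1.2 * n + v.1 := mod_cast h.den_eq
  have hnum : (ij.2.1 * m : ℝ) = ij.1.1 * n + v.2 := mod_cast h.num_eq
  have hdet : (ij.1.1 * ij.2.2 : ℝ) = ij.2.1 * ij.1.2 + k := mod_cast h.det_eq
  have hD₀ : (v.1 : ℝ) ≠ 0 := by positivity
  have hq₀ : (ij.2.2 : ℝ) ≠ 0 := by positivity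
  rw [point]
  field_simp
  linear_combination -(ij.2.1 : ℝ) * hden + ij.2.2 * hnum + n * hdet

theorem points_mem_Icc (h : IsLift m n k v ij) (hm : 0 < m) (hn : 0 < n) (hv : 0 < v.1)
    (hle : (m * v.1 : ℝ) ≤ ij.1.2) :
    point ij.1 ∈ Set.Icc (v.2 / v.1 : ℝ) (v.2 / v.1 + k * n * m / (v.1 : ℝ) ^ 2) ∧
      point ij.2 ∈ Set.Icc (v.2 / v.1 : ℝ) (v.2 / v.1 + k * n * m / (v.1 : ℝ) ^ 2) := by
  have hm₁ : (1 : ℝ) ≤ m := Nat.one_le_cast.2 hm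
  have hn₁ : (1 : ℝ) ≤ n := Nat.one_le_cast.2 hn
  have hq : 0 < ij.1.2 := Nat.cast_pos.1 (lt_of_lt_of_le (by positivity) hle)
  have hq' : 0 < ij.2.2 := Nat.pos_of_mul_pos_right (h.den_eq ▸ by positivity : 0 < ij.2.2 * m)
  have hD_le : (v.1 : ℝ) ≤ ij.2.2 * m := by
    exact_mod_cast h.den_eq ▸ Nat.le_add_left v.1 (ij.1.2 * n)
  rw [h.point_fst_eq hv hq, h.point_snd_eq hv hq']
  have hfst : k * m / (ij.1.2 * v.1 : ℝ) ≤ k * n * m / (v.1 : ℝ) ^ 2 := by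
    rw [div_le_div_iff₀ (by positivity) (by positivity)]
    calc (k * m * (v.1 : ℝ) ^ 2 : ℝ) = k * 1 * 1 * v.1 * (m * v.1) := by ring
      _ ≤ k * n * m * v.1 * ij.1.2 := by gcongr
      _ = k * n * m * (ij.1.2 * v.1) := by ring
  have hsnd : k * n / (ij.2.2 * v.1 : ℝ) ≤ k * n * m / (v.1 : ℝ) ^ 2 := by
    rw [div_le_div_iff₀ (by positivity) (by positivity)]
    calc (k * n * (v.1 : ℝ) ^ 2 : ℝ) = k * n * v.1 * v.1 := by ring
      _ ≤ k * n * v.1 * (ij.2.2 * m) := by gcongr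
      _ = k * n * m * (ij.2.2 * v.1) := by ring
  exact ⟨⟨le_add_of_nonneg_right (by positivity), by gcongr⟩,
    ⟨le_add_of_nonneg_right (by positivity), by gcongr⟩⟩

end IsLift

end Lifts

section Sectors

theorem mem_detPairs_of_mem_aboveHyperbola {I : Set ℝ} (hI : I ⊆ Set.Ioo 0 1) {Q k : ℕ} {c : ℝ}
    {ij : (ℕ × ℕ) × (ℕ × ℕ)} (hmem₁ : point ij.1 ∈ I) (hmem₂ : point ij.2 ∈ I)
    (hdet : ij.1.1 * ij.2.2 = ij.2.1 * ij.1.2 + k)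
    (hden : ((ij.1.2 : ℝ) / Q, (ij.2.2 : ℝ) / Q) ∈ aboveHyperbola c) : ij ∈ detPairs I Q k c := by
  obtain ⟨⟨hq, hq'⟩, hlarge⟩ := hden
  have mem_indices_of : ∀ i : ℕ × ℕ, point i ∈ I → (i.2 : ℝ) / Q ∈ Set.Ioc (0 : ℝ) 1 →
      0 < (Q : ℝ) ∧ i ∈ indices Q := by
    intro i hi hiQ
    have hQ : (0 : ℝ) < Q := (Nat.cast_nonneg Q).lt_of_ne' fun h => by simp [h] at hiQ
    have hi₂ : (0 : ℝ) < i.2 := (div_pos_iff_of_pos_right hQ).1 hiQ.1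
    refine ⟨hQ, mem_indices.2 ⟨?_, ?_, ?_⟩⟩
    · exact Nat.cast_pos.1 ((div_pos_iff_of_pos_right hi₂).1 (hI hi).1)
    · exact Nat.cast_lt.1 ((div_lt_one hi₂).1 (hI hi).2)
    · exact Nat.cast_le.1 ((div_le_one hQ).1 hiQ.2)
  obtain ⟨hQ, hi⟩ := mem_indices_of ij.1 hmem₁ hq
  refine mem_detPairs.2 ⟨⟨hi, (mem_indices_of ij.2 hmem₂ hq').2⟩, hmem₁, hmem₂, hdet, ?_⟩
  rwa [div_mul_div_comm, ← sq, le_div_iff₀ (by positivity)] at hlarge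

open scoped Classical in
/-- The elements of `detPairs I Q k c` whose ratio `q' / q` of denominators lies in `J`. -/
def sectorPairs (I : Set ℝ) (Q k : ℕ) (c : ℝ) (J : Set ℝ) : Finset ((ℕ × ℕ) × (ℕ × ℕ)) :=
  (detPairs I Q k c).filter fun ij => (ij.2.2 : ℝ) / ij.1.2 ∈ J

theorem mem_sectorPairs {I J : Set ℝ} {Q k : ℕ} {c : ℝ} {ij : (ℕ × ℕ) × (ℕ × ℕ)} :
    ij ∈ sectorPairs I Q k c J ↔ ij ∈ detPairs I Q k c ∧ (ij.2.2 : ℝ) / ij.1.2 ∈ J := by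
  simp only [sectorPairs, Finset.mem_filter]

/-- The interval of slopes `n / m + θ / m²` with `θ₁ ≤ θ ≤ θ₂`, where `v = (m, n)`. -/
def slopeInterval (θ₁ θ₂ : ℝ) (v : ℕ × ℕ) : Set ℝ :=
  Set.Icc (v.2 / v.1 + θ₁ / v.1 ^ 2 : ℝ) (v.2 / v.1 + θ₂ / v.1 ^ 2)

variable {k m n : ℕ} {θ₁ θ₂ ρ₁ ρ₂ b₁ b₂ b₃ c : ℝ}

theorem IsLift.slope_mem_slopeInterval {v : ℕ × ℕ} {ij : (ℕ × ℕ) × (ℕ × ℕ)}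
    (h : IsLift m n k v ij) (hm : 0 < m) (hq : 0 < ij.1.2) (hle : θ₁ * ij.1.2 ≤ m * v.1)
    (hge : (m * v.1 : ℝ) ≤ θ₂ * ij.1.2) :
    (ij.2.2 : ℝ) / ij.1.2 ∈ slopeInterval θ₁ θ₂ (m, n) := by
  have hq₀ : (0 : ℝ) < ij.1.2 := Nat.cast_pos.2 hq
  rw [h.slope_eq hm hq]
  rw [← le_div_iff₀ hq₀] at hle
  rw [← div_le_iff₀ hq₀] at hge
  constructor <;> gcongr

theorem IsLift.mem_sectorPairs_slopeInterval {Q : ℕ} {v : ℕ × ℕ} {ij : (ℕ × ℕ) × (ℕ × ℕ)}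
    (h : IsLift m n k v ij) (hm : 0 < m) (hn : 0 < n) (hθ₁ : 0 < θ₁) (hθ₂ : 0 < θ₂) (hθ₂' : θ₂ ≤ 1)
    (hρ₁ : 0 ≤ ρ₁) (hb₁ : 0 ≤ b₁) (hb : b₂ ≤ b₃) (hb₃ : b₃ ≤ 1)
    (hwindow : ∀ x ∈ Set.Icc ρ₁ ρ₂, ∀ s ∈ slopeInterval θ₁ θ₂ (m, n), (x, s * x) ∈ aboveHyperbola c)
    (hv : v ∈ latticePoints (trapezoid (θ₂ * ρ₁ / m) (θ₁ * ρ₂ / m) b₁ b₂) Q)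
    (hsmall : (k * n * m : ℝ) < (b₃ - b₂) * (θ₂ * ρ₁ / m * Q) ^ 2)
    (hle : θ₁ * ij.1.2 ≤ m * v.1) (hge : (m * v.1 : ℝ) ≤ θ₂ * ij.1.2) :
    ij ∈ sectorPairs (Set.Ioo b₁ b₃) Q k c (slopeInterval θ₁ θ₂ (m, n)) := by
  obtain ⟨⟨⟨hD, hDQ⟩, -⟩, ⟨hX₁, hX₂⟩, hlow, hhigh⟩ := mem_latticePoints.1 hv
  have hm₀ : (0 : ℝ) < m := Nat.cast_pos.2 hm
  have hD₀ : (0 : ℝ) < v.1 := Nat.cast_pos.2 hD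
  have hQ : (0 : ℝ) < Q := Nat.cast_pos.2 (hD.trans hDQ)
  have hqQ : (ij.1.2 : ℝ) / Q ∈ Set.Icc ρ₁ ρ₂ := by
    rw [div_lt_div_iff₀ hm₀ hQ] at hX₁
    rw [div_le_div_iff₀ hQ hm₀] at hX₂
    exact ⟨(le_div_iff₀ hQ).2 (le_of_mul_le_mul_left (by linarith) hθ₂),
      (div_le_iff₀ hQ).2 (le_of_mul_le_mul_left (by linarith) hθ₁)⟩
  have hmD_le : (m * v.1 : ℝ) ≤ ij.1.2 := hge.trans (mul_le_of_le_one_left (by positivity) hθ₂')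
  have hq : 0 < ij.1.2 := Nat.cast_pos.1 (lt_of_lt_of_le (by positivity) hmD_le)
  have hslope := h.slope_mem_slopeInterval hm hq hle hge
  have hIcc_subset : Set.Icc (v.2 / v.1 : ℝ) (v.2 / v.1 + k * n * m / (v.1 : ℝ) ^ 2) ⊆
      Set.Ioo b₁ b₃ := by
    refine Set.Icc_subset_Ioo ?_ ?_
    · rwa [lt_div_iff₀ hD₀, ← div_lt_div_iff_of_pos_right hQ, mul_div_assoc]
    · have hratio : (v.2 : ℝ) / v.1 < b₂ := by
        rwa [div_lt_iff₀ hD₀, ← div_lt_div_iff_of_pos_right hQ, mul_div_assoc]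
      have hgap : (k * n * m : ℝ) / (v.1 : ℝ) ^ 2 < b₃ - b₂ := by
        have hX₁D : θ₂ * ρ₁ / m * Q ≤ v.1 := ((lt_div_iff₀ hQ).1 hX₁).le
        rw [div_lt_iff₀ (by positivity)]
        exact hsmall.trans_le (by gcongr)
      linarith
  obtain ⟨hmem₁, hmem₂⟩ := h.points_mem_Icc hm hn hD hmD_le
  refine mem_sectorPairs.2 ⟨mem_detPairs_of_mem_aboveHyperbola (Set.Ioo_subset_Ioo hb₁ hb₃)
    (hIcc_subset hmem₁) (hIcc_subset hmem₂) h.det_eq ?_, hslope⟩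
  convert hwindow _ hqQ _ hslope using 2
  rw [div_mul_div_cancel₀ (Nat.cast_ne_zero.2 hq.ne')]

theorem sum_gcdWeight_le_card_sectorPairs {Q : ℕ} (hm : 0 < m) (hn : 0 < n) (hmn : m.Coprime n)
    (hθ₁ : 0 < θ₁) (hθ₂ : 0 < θ₂) (hθ₂' : θ₂ ≤ 1) (hρ₁ : 0 ≤ ρ₁) (hb₁ : 0 ≤ b₁) (hb : b₂ ≤ b₃)
    (hb₃ : b₃ ≤ 1)
    (hwindow : ∀ x ∈ Set.Icc ρ₁ ρ₂, ∀ s ∈ slopeInterval θ₁ θ₂ (m, n), (x, s * x) ∈ aboveHyperbola c)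
    (hsmall : (k * n * m : ℝ) < (b₃ - b₂) * (θ₂ * ρ₁ / m * Q) ^ 2) :
    (1 / θ₁ - 1 / θ₂ - 1) *
      ∑ v ∈ latticePoints (trapezoid (θ₂ * ρ₁ / m) (θ₁ * ρ₂ / m) b₁ b₂) Q, (gcdWeight k v : ℝ) ≤
      ((sectorPairs (Set.Ioo b₁ b₃) Q k c (slopeInterval θ₁ θ₂ (m, n))).card : ℝ) := by
  set V := latticePoints (trapezoid (θ₂ * ρ₁ / m) (θ₁ * ρ₂ / m) b₁ b₂) Q
  set P := sectorPairs (Set.Ioo b₁ b₃) Q k c (slopeInterval θ₁ θ₂ (m, n))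
  let proj (ij : (ℕ × ℕ) × (ℕ × ℕ)) : ℕ × ℕ :=
    (ij.2.2 * m - ij.1.2 * n, ij.2.1 * m - ij.1.1 * n)
  have hfiber : ∀ v ∈ V, (1 / θ₁ - 1 / θ₂ - 1) * (gcdWeight k v : ℝ) ≤
      ((P.filter fun ij => proj ij = v).card : ℝ) := by
    intro v hv
    obtain ⟨F, hcard, hF⟩ := exists_finset_isLift_gcdWeight_le hm hmn
      (mem_latticePoints.1 hv).1.1.1 k hθ₁ hθ₂
    refine hcard.trans (Nat.cast_le.2 (Finset.card_le_card fun ij hij => ?_))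
    obtain ⟨hlift, hle, hge⟩ := hF ij hij
    exact Finset.mem_filter.2 ⟨hlift.mem_sectorPairs_slopeInterval hm hn hθ₁ hθ₂ hθ₂' hρ₁ hb₁ hb hb₃
      hwindow hv hsmall hle hge, hlift.eq_sub⟩
  calc _ = ∑ v ∈ V, (1 / θ₁ - 1 / θ₂ - 1) * (gcdWeight k v : ℝ) := Finset.mul_sum _ _ _
    _ ≤ ∑ v ∈ V, ((P.filter fun ij => proj ij = v).card : ℝ) := Finset.sum_le_sum hfiber
    _ ≤ P.card := by
      rw [← Nat.cast_sum, Finset.sum_card_fiberwise_eq_card_filter]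
      exact Nat.cast_le.2 (Finset.card_filter_le _ _)

theorem liminfGE_card_sectorPairs (hk : 0 < k) (hm : 0 < m) (hn : 0 < n) (hmn : m.Coprime n)
    (hθ₁ : 0 < θ₁) (hθ : θ₁ ≤ θ₂) (hθ₂ : θ₂ ≤ 1) (hρ₁ : 0 < ρ₁) (hρ₂ : ρ₂ ≤ 1)
    (hρ : θ₂ * ρ₁ ≤ θ₁ * ρ₂) (hb₁ : 0 ≤ b₁) (hb : b₁ < b₃) (hb₃ : b₃ ≤ 1)
    (hwindow : ∀ x ∈ Set.Icc ρ₁ ρ₂, ∀ s ∈ slopeInterval θ₁ θ₂ (m, n),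
      (x, s * x) ∈ aboveHyperbola c) :
    LiminfGE atTop (fun Q : ℕ =>
        ((sectorPairs (Set.Ioo b₁ b₃) Q k c (slopeInterval θ₁ θ₂ (m, n))).card : ℝ) / (Q : ℝ) ^ 2)
      ((1 / θ₁ - 1 / θ₂ - 1) *
        (meanWeight k * ((b₃ - b₁) * ((θ₁ * ρ₂ / m) ^ 2 - (θ₂ * ρ₁ / m) ^ 2) / 2))) := by
  have hθ₂₀ : 0 < θ₂ := hθ₁.trans_le hθ
  have hm₁ : (1 : ℝ) ≤ m := Nat.one_le_cast.2 hm
  have hX₂ : θ₁ * ρ₂ / m ≤ 1 := by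
    rw [div_le_one (by positivity)]
    nlinarith
  refine LiminfGE.closure (m := 𝓝[<] b₃) (a := fun b₂ => (1 / θ₁ - 1 / θ₂ - 1) *
    (meanWeight k * ((b₂ - b₁) * ((θ₁ * ρ₂ / m) ^ 2 - (θ₂ * ρ₁ / m) ^ 2) / 2)))
    (Continuous.tendsto' (by fun_prop) _ _ rfl |>.mono_left nhdsWithin_le_nhds) ?_
  filter_upwards [Ioo_mem_nhdsLT hb] with b₂ hb₂
  have hlim := ((isJordanRegion_trapezoid (X₁ := θ₂ * ρ₁ / m) (by positivity) hX₂ hb₁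
    (hb₂.2.le.trans hb₃)).tendsto_sum_gcdWeight hk).const_mul (1 / θ₁ - 1 / θ₂ - 1)
  rw [volume_real_trapezoid (by positivity) (by gcongr) hb₂.1.le] at hlim
  have hlarge : Tendsto (fun Q : ℕ => (b₃ - b₂) * (θ₂ * ρ₁ / m * (Q : ℝ)) ^ 2) atTop atTop :=
    ((tendsto_pow_atTop two_ne_zero).comp (tendsto_natCast_atTop_atTop.const_mul_atTop
      (by positivity))).const_mul_atTop (sub_pos.2 hb₂.2)
  refine (LiminfGE.of_tendsto hlim).mono ?_
  filter_upwards [hlarge.eventually_gt_atTop (k * n * m : ℝ)] with Q hsmall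
  rw [← mul_div_assoc]
  gcongr
  exact sum_gcdWeight_le_card_sectorPairs hm hn hmn hθ₁ hθ₂₀ hθ₂ hρ₁.le hb₁ hb₂.2.le hb₃ hwindow
    hsmall

end Sectors

section SlopeCovering

theorem frequently_exists_coprime_abs_sub_lt {x : ℝ} (hx : Irrational x) (hpos : 0 < x) :
    ∃ᶠ m : ℕ in atTop, ∃ n : ℕ, 0 < n ∧ m.Coprime n ∧ |x - n / m| < 1 / (m : ℝ) ^ 2 := by
  refine frequently_atTop.2 fun M => ?_
  obtain ⟨ε, hfar, hε, hεx⟩ := ((hx.eventually_forall_le_dist_cast_rat_of_den_le M).filter_mono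
    nhdsWithin_le_nhds |>.and (Ioo_mem_nhdsGT hpos)).exists
  obtain ⟨N, hN⟩ := exists_nat_one_div_lt hε
  obtain ⟨q, hq, hden⟩ := Real.exists_rat_abs_sub_le_and_den_le x N.succ_pos
  have hd : (1 : ℝ) ≤ q.den := Nat.one_le_cast.2 q.den_pos
  have hden' : (q.den : ℝ) ≤ N + 1 := mod_cast hden
  have hclose : |x - q| < ε := by
    refine (hq.trans ?_).trans_lt hN
    push_cast
    gcongr
    nlinarith
  have hclose' : |x - q| < 1 / (q.den : ℝ) ^ 2 := by
    refine hq.trans_lt ?_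
    push_cast
    gcongr
    nlinarith
  have hq₀ : 0 < q := Rat.cast_pos.1 (by linarith [(abs_lt.1 hclose).2] : (0 : ℝ) < q)
  have hnum : ((q.num.toNat : ℕ) : ℤ) = q.num := Int.toNat_of_nonneg (Rat.num_nonneg.2 hq₀.le)
  refine ⟨q.den, (not_le.1 fun hle => (hfar q hle).not_gt hclose).le, q.num.toNat, ?_, ?_, ?_⟩
  · exact Int.pos_iff_toNat_pos.1 (Rat.num_pos.2 hq₀)
  · rw [show q.num.toNat = q.num.natAbs by omega]
    exact q.reduced.symm
  · rwa [show ((q.num.toNat : ℕ) : ℝ) / q.den = q by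
      rw [Rat.cast_def q]; congr 1; exact_mod_cast congrArg (Int.cast (R := ℝ)) hnum]

/-- Admissible members `v = (m, n)` of the covering of the slopes `U` by the intervals
`slopeInterval θ₁ θ₂ v`, with lengths at most `δ`. -/
structure IsSlopeWindow (θ₁ θ₂ δ : ℝ) (U : Set ℝ) (v : ℕ × ℕ) : Prop where
  fst_pos : 0 < v.1
  snd_pos : 0 < v.2
  coprime : v.1.Coprime v.2
  subset : slopeInterval θ₁ θ₂ v ⊆ U
  length_le : (θ₂ - θ₁) / (v.1 : ℝ) ^ 2 ≤ δ

variable {θ₁ θ₂ δ x : ℝ} {U : Set ℝ} {v : ℕ × ℕ}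

theorem slopeInterval_subset_closedBall (hθ₁ : 0 ≤ θ₁) (hθ₂ : θ₂ ≤ 1)
    (hx : |x - v.2 / v.1| < 1 / (v.1 : ℝ) ^ 2) :
    slopeInterval θ₁ θ₂ v ⊆ Metric.closedBall x (2 / (v.1 : ℝ) ^ 2) := by
  rintro y ⟨hleft, hright⟩
  have hθ₁' : 0 ≤ θ₁ / (v.1 : ℝ) ^ 2 := by positivity
  have hθ₂' : θ₂ / (v.1 : ℝ) ^ 2 ≤ 1 / (v.1 : ℝ) ^ 2 := by gcongr
  have htwo : 2 / (v.1 : ℝ) ^ 2 = 1 / (v.1 : ℝ) ^ 2 + 1 / (v.1 : ℝ) ^ 2 := by ring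
  rw [abs_lt] at hx
  rw [Metric.mem_closedBall, Real.dist_eq, htwo, abs_le]
  constructor <;> linarith [hx.1, hx.2]

theorem volume_closedBall_eq_mul_volume_slopeInterval (hθ : θ₁ < θ₂) (hv : 0 < v.1) (x : ℝ) :
    volume (Metric.closedBall x (3 * (2 / (v.1 : ℝ) ^ 2))) =
      (12 / (θ₂ - θ₁)).toNNReal * volume (slopeInterval θ₁ θ₂ v) := by
  have hθ₀ : 0 < θ₂ - θ₁ := sub_pos.2 hθ
  rw [slopeInterval, Real.volume_closedBall, Real.volume_Icc, ENNReal.ofNNReal_toNNReal,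
    ← ENNReal.ofReal_mul (by positivity)]
  congr 1
  field_simp
  ring

theorem exists_isSlopeWindow (hθ₁ : 0 ≤ θ₁) (hθ₂ : θ₂ ≤ 1) (hδ : 0 < δ) (hU : IsOpen U)
    (hUpos : U ⊆ Set.Ioi 0) (hx : Irrational x) (hxU : x ∈ U) {ε : ℝ} (hε : 0 < ε) :
    ∃ v, IsSlopeWindow θ₁ θ₂ δ U v ∧ |x - v.2 / v.1| < 1 / (v.1 : ℝ) ^ 2 ∧
      2 / (v.1 : ℝ) ^ 2 ≤ ε := by
  obtain ⟨r, hr, hball⟩ := Metric.nhds_basis_closedBall.mem_iff.1 (hU.mem_nhds hxU)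
  have hzero : Tendsto (fun m : ℕ => 2 / (m : ℝ) ^ 2) atTop (𝓝 0) :=
    tendsto_const_nhds.div_atTop ((tendsto_pow_atTop two_ne_zero).comp tendsto_natCast_atTop_atTop)
  obtain ⟨m, ⟨n, hn, hmn, hclose⟩, hmr, hmδ, hmε, hm⟩ :=
    ((frequently_exists_coprime_abs_sub_lt hx (hUpos hxU)).and_eventually
      ((hzero.eventually_le_const hr).and ((hzero.eventually_le_const hδ).and
        ((hzero.eventually_le_const hε).and (eventually_gt_atTop 0))))).exists
  refine ⟨(m, n), ⟨hm, hn, hmn, ?_, ?_⟩, hclose, hmε⟩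
  · exact (slopeInterval_subset_closedBall hθ₁ hθ₂ hclose).trans
      ((Metric.closedBall_subset_closedBall hmr).trans hball)
  · refine le_trans ?_ hmδ
    gcongr
    linarith

theorem exists_ae_slopeInterval_cover (hθ₁ : 0 ≤ θ₁) (hθ : θ₁ < θ₂) (hθ₂ : θ₂ ≤ 1) (hδ : 0 < δ)
    (hU : IsOpen U) (hUpos : U ⊆ Set.Ioi 0) :
    ∃ u : Set (ℕ × ℕ), (∀ v ∈ u, IsSlopeWindow θ₁ θ₂ δ U v) ∧
      u.PairwiseDisjoint (slopeInterval θ₁ θ₂) ∧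
      (⋃ v ∈ u, slopeInterval θ₁ θ₂ v) =ᵐ[volume] U := by
  obtain ⟨u, hut, -, hdisj, hnull⟩ := Vitali.exists_disjoint_covering_ae volume
    {x | Irrational x ∧ x ∈ U}
    {i : ℝ × (ℕ × ℕ) | IsSlopeWindow θ₁ θ₂ δ U i.2 ∧
      |i.1 - i.2.2 / i.2.1| < 1 / (i.2.1 : ℝ) ^ 2}
    (12 / (θ₂ - θ₁)).toNNReal (fun i => 2 / (i.2.1 : ℝ) ^ 2) Prod.fst
    (fun i => slopeInterval θ₁ θ₂ i.2)
    (fun i hi => slopeInterval_subset_closedBall hθ₁ hθ₂ hi.2)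
    (fun i hi => (volume_closedBall_eq_mul_volume_slopeInterval hθ hi.1.fst_pos i.1).le)
    (fun i hi => by
      have hm : (0 : ℝ) < i.2.1 := Nat.cast_pos.2 hi.1.fst_pos
      rw [slopeInterval, interior_Icc, Set.nonempty_Ioo]
      gcongr)
    (fun i _ => isClosed_Icc)
    (fun x hx ε hε => by
      obtain ⟨v, hv, hclose, hvε⟩ := exists_isSlopeWindow hθ₁ hθ₂ hδ hU hUpos hx.1 hx.2 hε
      exact ⟨(x, v), ⟨hv, hclose⟩, hvε, rfl⟩)
  have hwindow : ∀ v ∈ Prod.snd '' u, IsSlopeWindow θ₁ θ₂ δ U v :=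
    Set.forall_mem_image.2 fun i hi => (hut hi).1
  refine ⟨Prod.snd '' u, hwindow, ?_, ?_⟩
  · rintro _ ⟨i, hi, rfl⟩ _ ⟨j, hj, rfl⟩ hij
    exact hdisj hi hj (ne_of_apply_ne _ hij)
  · refine (LE.le.eventuallyLE (Set.iUnion₂_subset fun v hv =>
      (hwindow v hv).subset)).antisymm ?_
    refine ae_le_set.2 (measure_mono_null (fun x hx => ?_) (measure_union_null hnull
      ((Set.countable_range ((↑) : ℚ → ℝ)).measure_zero volume)))
    rw [Set.biUnion_image] at hx
    by_cases hrat : Irrational x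
    · exact Or.inl ⟨⟨hrat, hx.1⟩, hx.2⟩
    · exact Or.inr (not_not.1 hrat)

theorem exists_finset_slopeInterval_lt_sum (hθ₁ : 0 ≤ θ₁) (hθ : θ₁ < θ₂) (hθ₂ : θ₂ ≤ 1)
    (hδ : 0 < δ) (hU : IsOpen U) (hUpos : U ⊆ Set.Ioi 0) {f : ℝ → ℝ} (hf : IntegrableOn f U) {L : ℝ}
    (hL : L < ∫ x in U, f x) :
    ∃ u : Finset (ℕ × ℕ), (∀ v ∈ u, IsSlopeWindow θ₁ θ₂ δ U v) ∧
      (u : Set (ℕ × ℕ)).PairwiseDisjoint (slopeInterval θ₁ θ₂) ∧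
      L < ∑ v ∈ u, ∫ x in slopeInterval θ₁ θ₂ v, f x := by
  obtain ⟨u, hwindow, hdisj, hae⟩ := exists_ae_slopeInterval_cover hθ₁ hθ hθ₂ hδ hU hUpos
  rw [Set.biUnion_eq_iUnion] at hae
  have hsum : HasSum (fun v : u => ∫ x in slopeInterval θ₁ θ₂ v, f x) (∫ x in U, f x) := by
    rw [← setIntegral_congr_set hae]
    exact hasSum_integral_iUnion (fun _ => measurableSet_Icc)
      (fun v w hvw => hdisj v.2 w.2 (Subtype.coe_ne_coe.2 hvw))
      (hf.mono_set (Set.iUnion_subset fun v => (hwindow v v.2).subset))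
  obtain ⟨s, hs⟩ := (hsum.eventually_const_lt hL).exists
  refine ⟨s.map (Function.Embedding.subtype _), ?_, ?_, by rwa [Finset.sum_map]⟩
  · simp only [Finset.forall_mem_map]
    exact fun v _ => hwindow v v.2
  · refine hdisj.subset ?_
    simp

end SlopeCovering

section SlopeDensity

/-- The density of the slope `y / x` on the region `x * y ≥ c` of the unit square: its value at
`s ∈ [c, c⁻¹]` is the integral of `t` over the `t > 0` with `(t, s * t) ∈ aboveHyperbola c`. -/
def slopeDensity (c s : ℝ) : ℝ := ((min 1 s⁻¹) ^ 2 - c / s) / 2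

variable {c η x x₁ x₂ s t : ℝ}

theorem continuousOn_slopeDensity (c : ℝ) : ContinuousOn (slopeDensity c) (Set.Ioi 0) := by
  have hne : ∀ s ∈ Set.Ioi (0 : ℝ), s ≠ 0 := fun s hs => ne_of_gt hs
  exact ((((continuous_const.min continuous_id).comp_continuousOn
    (continuousOn_inv₀.mono hne)).pow 2).sub
    (continuousOn_const.div continuousOn_id hne)).div_const 2

theorem intervalIntegrable_slopeDensity (c : ℝ) {a b : ℝ} (ha : 0 < a) (hab : a ≤ b) :
    IntervalIntegrable (slopeDensity c) volume a b :=
  ContinuousOn.intervalIntegrable_of_Icc hab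
    ((continuousOn_slopeDensity c).mono fun _ hs => ha.trans_le hs.1)

theorem integral_slopeDensity_left (hc : 0 < c) (hc1 : c ≤ 1) :
    ∫ s in c..1, slopeDensity c s = hyperbolaArea c / 2 := by
  have hderiv : ∀ s ∈ Set.uIcc c 1,
      HasDerivAt (fun s => (s - c * Real.log s) / 2) (slopeDensity c s) s := by
    intro s hs
    rw [Set.uIcc_of_le hc1] at hs
    have hs₀ : 0 < s := hc.trans_le hs.1
    refine (((hasDerivAt_id' s).fun_sub
      ((Real.hasDerivAt_log hs₀.ne').const_mul c)).div_const 2).congr_deriv ?_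
    rw [slopeDensity, min_eq_left ((one_le_inv₀ hs₀).2 hs.2)]
    ring
  rw [intervalIntegral.integral_eq_sub_of_hasDerivAt hderiv
    (intervalIntegrable_slopeDensity c hc hc1), hyperbolaArea, Real.log_one]
  ring

theorem integral_slopeDensity_right (hc : 0 < c) (hc1 : c ≤ 1) :
    ∫ s in (1 : ℝ)..c⁻¹, slopeDensity c s = hyperbolaArea c / 2 := by
  have hc1' : 1 ≤ c⁻¹ := (one_le_inv₀ hc).2 hc1
  have hderiv : ∀ s ∈ Set.uIcc 1 c⁻¹,
      HasDerivAt (fun s => (-s⁻¹ - c * Real.log s) / 2) (slopeDensity c s) s := by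
    intro s hs
    rw [Set.uIcc_of_le hc1'] at hs
    have hs₀ : 0 < s := one_pos.trans_le hs.1
    refine (((hasDerivAt_inv hs₀.ne').fun_neg.fun_sub
      ((Real.hasDerivAt_log hs₀.ne').const_mul c)).div_const 2).congr_deriv ?_
    rw [slopeDensity, min_eq_right (inv_le_one_of_one_le₀ hs.1)]
    field_simp
  rw [intervalIntegral.integral_eq_sub_of_hasDerivAt hderiv
    (intervalIntegrable_slopeDensity c one_pos hc1'), hyperbolaArea, Real.log_one, Real.log_inv,
    inv_inv]
  ring

theorem integrableOn_slopeDensity (hc : 0 < c) :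
    IntegrableOn (slopeDensity c) (Set.Ioo c c⁻¹) :=
  (((continuousOn_slopeDensity c).mono fun _ hs => hc.trans_le hs.1).integrableOn_Icc).mono_set
    Set.Ioo_subset_Icc_self

theorem setIntegral_slopeDensity (hc : 0 < c) (hc1 : c ≤ 1) :
    ∫ s in Set.Ioo c c⁻¹, slopeDensity c s = hyperbolaArea c := by
  have hc1' : 1 ≤ c⁻¹ := (one_le_inv₀ hc).2 hc1
  rw [← integral_Ioc_eq_integral_Ioo, ← intervalIntegral.integral_of_le (hc1.trans hc1'),
    ← intervalIntegral.integral_add_adjacent_intervals (intervalIntegrable_slopeDensity c hc hc1)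
      (intervalIntegrable_slopeDensity c one_pos hc1'),
    integral_slopeDensity_left hc hc1, integral_slopeDensity_right hc hc1, add_halves]

theorem one_sub_mul_min_one_inv_le (hη : 0 ≤ η) (hη1 : η ≤ 1) (hx : 0 < x) (hx₂ : 0 < x₂)
    (h : x₂ * (1 - η) ≤ x) : (1 - η) * min 1 x⁻¹ ≤ min 1 x₂⁻¹ := by
  have : 0 ≤ 1 - η := sub_nonneg.2 hη1
  refine le_min ?_ ?_
  · calc (1 - η) * min 1 x⁻¹ ≤ (1 - η) * 1 := by gcongr; exact min_le_left _ _
      _ ≤ 1 := by linarith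
  · calc (1 - η) * min 1 x⁻¹ ≤ (1 - η) * x⁻¹ := by gcongr; exact min_le_right _ _
      _ ≤ x₂⁻¹ := by
        rw [← div_eq_mul_inv, div_le_iff₀ hx, inv_mul_eq_div, le_div_iff₀ hx₂]
        linarith

theorem sq_sub_four_mul_le (hη1 : η ≤ 1) (ht : 0 ≤ t) (ht1 : t ≤ 1) (hη : 0 ≤ η) :
    t ^ 2 - 4 * η ≤ (1 - η) ^ 2 * ((1 - η) * t) ^ 2 := by
  have bernoulli := one_add_mul_le_pow (a := -η) (by linarith) 4
  have ht2 : t ^ 2 ≤ 1 := pow_le_one₀ ht ht1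
  calc t ^ 2 - 4 * η ≤ (1 - 4 * η) * t ^ 2 := by nlinarith
    _ ≤ (1 - η) ^ 4 * t ^ 2 := by
      gcongr
      push_cast at bernoulli
      rw [← sub_eq_add_neg] at bernoulli
      linarith
    _ = _ := by ring

theorem slopeDensity_sub_le (hc : 0 < c) (hη : 0 ≤ η) (hη1 : η ≤ 1) (hcx : c ≤ x₁)
    (hlen : x₂ - x₁ ≤ η * c) (hs : s ∈ Set.Icc x₁ x₂) :
    slopeDensity c s - 3 * η ≤ ((1 - η) ^ 2 * (min 1 x₂⁻¹) ^ 2 - c / x₁) / 2 := by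
  have hx₁ : 0 < x₁ := hc.trans_le hcx
  have hs₀ : 0 < s := hx₁.trans_le hs.1
  have hx₂ : 0 < x₂ := hs₀.trans_le hs.2
  have hdiv : c / x₁ - c / s ≤ η := by
    rw [div_sub_div _ _ hx₁.ne' hs₀.ne', div_le_iff₀ (by positivity)]
    calc c * s - x₁ * c = c * (s - x₁) := by ring
      _ ≤ c * (η * c) := by gcongr; linarith [hs.2]
      _ = η * (c * c) := by ring
      _ ≤ η * (x₁ * s) := by gcongr; exact hcx.trans hs.1
  have hmin : (1 - η) * min 1 s⁻¹ ≤ min 1 x₂⁻¹ := by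
    refine one_sub_mul_min_one_inv_le hη hη1 hs₀ hx₂ ?_
    nlinarith [hs.1, hs.2]
  have hμ : 0 ≤ min 1 s⁻¹ := le_min zero_le_one (by positivity)
  have : 0 ≤ 1 - η := sub_nonneg.2 hη1
  have hsq : (min 1 s⁻¹) ^ 2 - 4 * η ≤ (1 - η) ^ 2 * (min 1 x₂⁻¹) ^ 2 :=
    (sq_sub_four_mul_le hη1 hμ (min_le_left _ _) hη).trans (by gcongr)
  rw [slopeDensity]
  linarith

theorem setIntegral_slopeDensity_sub_le (hc : 0 < c) (hη : 0 ≤ η) (hη1 : η ≤ 1) (hcx : c ≤ x₁)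
    (hx : x₁ ≤ x₂) (hlen : x₂ - x₁ ≤ η * c) :
    ∫ s in Set.Icc x₁ x₂, (slopeDensity c s - 3 * η) ≤
      (x₂ - x₁) * (((1 - η) ^ 2 * (min 1 x₂⁻¹) ^ 2 - c / x₁) / 2) := by
  have hcont : ContinuousOn (fun s => slopeDensity c s - 3 * η) (Set.Icc x₁ x₂) :=
    ((continuousOn_slopeDensity c).mono fun s hs => (hc.trans_le hcx).trans_le hs.1).sub
      continuousOn_const
  refine (setIntegral_mono_on hcont.integrableOn_Icc continuousOn_const.integrableOn_Icc
    measurableSet_Icc fun s hs => slopeDensity_sub_le hc hη hη1 hcx hlen hs).trans_eq ?_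
  rw [setIntegral_const, Real.volume_real_Icc_of_le hx, smul_eq_mul]

end SlopeDensity

section LowerBound

variable {c η x₁ x₂ b₁ b₃ s t : ℝ} {k m n : ℕ}

theorem mk_mul_mem_aboveHyperbola (hc : 0 < c) (hx₁ : 0 < x₁)
    (ht : t ∈ Set.Icc √(c / x₁) (min 1 x₂⁻¹)) (hs : s ∈ Set.Icc x₁ x₂) :
    (t, s * t) ∈ aboveHyperbola c := by
  have hs₀ : 0 < s := hx₁.trans_le hs.1
  have hx₂ : 0 < x₂ := hs₀.trans_le hs.2
  have ht₀ : 0 < t := (Real.sqrt_pos.2 (by positivity)).trans_le ht.1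
  refine ⟨⟨⟨ht₀, ht.2.trans (min_le_left _ _)⟩, mul_pos hs₀ ht₀, ?_⟩, ?_⟩
  · calc s * t ≤ x₂ * x₂⁻¹ := by
          gcongr
          exacts [hs.2, ht.2.trans (min_le_right _ _)]
      _ = 1 := mul_inv_cancel₀ hx₂.ne'
  · calc c = x₁ * (c / x₁) := (mul_div_cancel₀ c hx₁.ne').symm
      _ ≤ s * t ^ 2 := by
        gcongr
        exacts [hs.1, (Real.sqrt_le_left ht₀.le).1 ht.1]
      _ = t * (s * t) := by ring

/- With `θ₁ = (1 - η) η²` and `θ₂ = η²`, the factor `1 / θ₁ - 1 / θ₂ - 1` counting the lifts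
is `(1 / (1 - η) - η) / η ≥ 1 / η`, so the loss of one lift per progression is harmless. -/
theorem liminfGE_card_sectorPairs_Icc (hk : 0 < k) (hm : 0 < m) (hn : 0 < n) (hmn : m.Coprime n)
    (hη : 0 < η) (hη1 : η < 1) (hc : 0 < c) (hb₁ : 0 ≤ b₁) (hb : b₁ < b₃) (hb₃ : b₃ ≤ 1)
    (hx₁ : x₁ = n / m + (1 - η) * η ^ 2 / m ^ 2) (hx₂ : x₂ = n / m + η ^ 2 / m ^ 2) :
    LiminfGE atTop (fun Q : ℕ =>
        ((sectorPairs (Set.Ioo b₁ b₃) Q k c (Set.Icc x₁ x₂)).card : ℝ) / (Q : ℝ) ^ 2)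
      (meanWeight k * (b₃ - b₁) *
        ((x₂ - x₁) * (((1 - η) ^ 2 * (min 1 x₂⁻¹) ^ 2 - c / x₁) / 2))) := by
  have hη' : 0 < 1 - η := sub_pos.2 hη1
  have hx₁₀ : 0 < x₁ := by rw [hx₁]; positivity
  have hlen : x₂ - x₁ = η ^ 3 / m ^ 2 := by rw [hx₁, hx₂]; ring
  have hlen₀ : 0 ≤ η ^ 3 / (m : ℝ) ^ 2 := by positivity
  have hx₂₀ : 0 < x₂ := by rw [hx₂]; positivity
  have hmin : 0 < min 1 x₂⁻¹ := lt_min one_pos (by positivity)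
  have hκ : 0 ≤ meanWeight k * (b₃ - b₁) := mul_nonneg (meanWeight_nonneg k) (sub_nonneg.2 hb.le)
  have hsqrt : √(c / x₁) ^ 2 = c / x₁ := Real.sq_sqrt (by positivity)
  rw [← hsqrt, hlen, ← mul_pow]
  rcases le_or_gt √(c / x₁) ((1 - η) * min 1 x₂⁻¹) with hle | hlt
  · have hlower := liminfGE_card_sectorPairs (θ₁ := (1 - η) * η ^ 2) (θ₂ := η ^ 2) (c := c)
      (ρ₁ := √(c / x₁)) (ρ₂ := min 1 x₂⁻¹) hk hm hn hmn (by positivity)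
      (mul_le_of_le_one_left (by positivity) (by linarith)) (pow_le_one₀ hη.le hη1.le)
      (Real.sqrt_pos.2 (by positivity)) (min_le_left _ _)
      ((mul_le_mul_of_nonneg_left hle (by positivity)).trans_eq (by ring)) hb₁ hb hb₃
      fun t ht s hs => mk_mul_mem_aboveHyperbola hc hx₁₀ ht (by rwa [hx₁, hx₂])
    rw [slopeInterval, ← hx₁, ← hx₂] at hlower
    refine hlower.anti ?_
    have hheight : 0 ≤ (((1 - η) * min 1 x₂⁻¹) ^ 2 - √(c / x₁) ^ 2) / 2 :=
      div_nonneg (sub_nonneg.2 (by gcongr)) two_pos.le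
    have hfactor : 1 ≤ 1 / (1 - η) - η := by
      rw [le_sub_iff_add_le, le_div_iff₀ hη']
      nlinarith
    refine (mul_le_mul_of_nonneg_left (le_mul_of_one_le_left (mul_nonneg hlen₀ hheight) hfactor)
      hκ).trans_eq ?_
    field_simp
    ring
  · refine LiminfGE.of_nonpos (fun Q => by positivity)
      (mul_nonpos_of_nonneg_of_nonpos hκ (mul_nonpos_of_nonneg_of_nonpos hlen₀ ?_))
    exact div_nonpos_of_nonpos_of_nonneg (sub_nonpos.2 (by gcongr)) two_pos.le

theorem liminfGE_card_sectorPairs_slopeDensity {v : ℕ × ℕ} (hk : 0 < k) (hη : 0 < η) (hη1 : η < 1)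
    (hc : 0 < c) (hb₁ : 0 ≤ b₁) (hb : b₁ < b₃) (hb₃ : b₃ ≤ 1)
    (hv : IsSlopeWindow ((1 - η) * η ^ 2) (η ^ 2) (η * c) (Set.Ioo c c⁻¹) v) :
    LiminfGE atTop (fun Q : ℕ => ((sectorPairs (Set.Ioo b₁ b₃) Q k c
        (slopeInterval ((1 - η) * η ^ 2) (η ^ 2) v)).card : ℝ) / (Q : ℝ) ^ 2)
      (meanWeight k * (b₃ - b₁) *
        ∫ s in slopeInterval ((1 - η) * η ^ 2) (η ^ 2) v, (slopeDensity c s - 3 * η)) := by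
  refine (liminfGE_card_sectorPairs_Icc hk hv.fst_pos hv.snd_pos hv.coprime hη hη1 hc hb₁ hb hb₃ rfl
    rfl).anti (mul_le_mul_of_nonneg_left ?_
      (mul_nonneg (meanWeight_nonneg k) (sub_nonneg.2 hb.le)))
  have hle : v.2 / v.1 + (1 - η) * η ^ 2 / (v.1 : ℝ) ^ 2 ≤ v.2 / v.1 + η ^ 2 / (v.1 : ℝ) ^ 2 := by
    gcongr
    exact mul_le_of_le_one_left (by positivity) (by linarith)
  refine setIntegral_slopeDensity_sub_le hc hη.le hη1.le
    (hv.subset (Set.left_mem_Icc.2 hle)).1.le hle (le_of_eq_of_le ?_ hv.length_le)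
  ring

theorem sum_card_sectorPairs_le {ι : Type*} (I : Set ℝ) (Q k : ℕ) (c : ℝ) {J : ι → Set ℝ}
    {u : Finset ι} (hu : (u : Set ι).PairwiseDisjoint J) :
    ∑ i ∈ u, (sectorPairs I Q k c (J i)).card ≤ (detPairs I Q k c).card := by
  rw [← Finset.card_biUnion]
  · exact Finset.card_le_card (Finset.biUnion_subset.2 fun i _ ij hij => (mem_sectorPairs.1 hij).1)
  · intro i hi j hj hij
    exact Finset.disjoint_left.2 fun _ hi' hj' => Set.disjoint_left.1 (hu hi hj hij)
      (mem_sectorPairs.1 hi').2 (mem_sectorPairs.1 hj').2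

theorem liminfGE_card_detPairs_slopeDensity (hk : 0 < k) (hη : 0 < η) (hη1 : η < 1)
    (hc : 0 < c) (hb₁ : 0 ≤ b₁) (hb : b₁ < b₃) (hb₃ : b₃ ≤ 1) :
    LiminfGE atTop (fun Q : ℕ => ((detPairs (Set.Ioo b₁ b₃) Q k c).card : ℝ) / (Q : ℝ) ^ 2)
      (meanWeight k * (b₃ - b₁) * ∫ s in Set.Ioo c c⁻¹, (slopeDensity c s - 3 * η)) := by
  set κ := meanWeight k * (b₃ - b₁)
  have hκ : 0 ≤ κ := mul_nonneg (meanWeight_nonneg k) (sub_nonneg.2 hb.le)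
  refine LiminfGE.closure (m := 𝓝[<] ∫ s in Set.Ioo c c⁻¹, (slopeDensity c s - 3 * η))
    (a := fun L => κ * L)
    (((continuous_const_mul κ).tendsto _).mono_left nhdsWithin_le_nhds) ?_
  filter_upwards [self_mem_nhdsWithin] with L hL
  obtain ⟨u, hwindow, hdisj, hsum⟩ := exists_finset_slopeInterval_lt_sum
    (θ₁ := (1 - η) * η ^ 2) (θ₂ := η ^ 2) (δ := η * c)
    (mul_nonneg (sub_nonneg.2 hη1.le) (by positivity))
    (mul_lt_of_lt_one_left (by positivity) (by linarith)) (pow_le_one₀ hη.le hη1.le)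
    (by positivity) isOpen_Ioo (fun s hs => hc.trans hs.1)
    ((integrableOn_slopeDensity hc).sub (integrableOn_const measure_Ioo_lt_top.ne)) hL
  refine ((LiminfGE.sum fun v hv => liminfGE_card_sectorPairs_slopeDensity hk hη hη1 hc hb₁ hb hb₃
    (hwindow v hv)).mono (Eventually.of_forall fun Q => ?_)).anti ?_
  · rw [← Finset.sum_div, ← Nat.cast_sum]
    gcongr
    exact sum_card_sectorPairs_le _ Q k c hdisj
  · rw [← Finset.mul_sum]
    exact mul_le_mul_of_nonneg_left hsum.le hκ

theorem liminfGE_card_detPairs (hk : 0 < k) (hc : 0 < c) (hc1 : c ≤ 1) (hb₁ : 0 ≤ b₁)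
    (hb : b₁ ≤ b₃) (hb₃ : b₃ ≤ 1) :
    LiminfGE atTop (fun Q : ℕ => ((detPairs (Set.Ioo b₁ b₃) Q k c).card : ℝ) / (Q : ℝ) ^ 2)
      (meanWeight k * hyperbolaArea c * (b₃ - b₁)) := by
  rcases hb.eq_or_lt with rfl | hlt
  · exact LiminfGE.of_nonpos (fun Q => by positivity) (by simp)
  have hcc : c ≤ c⁻¹ := hc1.trans ((one_le_inv₀ hc).2 hc1)
  refine LiminfGE.closure (m := 𝓝[>] 0) (a := fun η : ℝ => meanWeight k * (b₃ - b₁) *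
    (hyperbolaArea c - 3 * η * (c⁻¹ - c))) (Continuous.tendsto' (by fun_prop) _ _ (by ring)
    |>.mono_left nhdsWithin_le_nhds) ?_
  filter_upwards [Ioo_mem_nhdsGT one_pos] with η hη
  convert liminfGE_card_detPairs_slopeDensity hk hη.1 hη.2 hc hb₁ hlt hb₃ using 2
  rw [integral_sub (integrableOn_slopeDensity hc) (integrableOn_const measure_Ioo_lt_top.ne),
    setIntegral_slopeDensity hc hc1, setIntegral_const, Real.volume_real_Ioo_of_le hcc, smul_eq_mul]
  ring

end LowerBound

section Density

variable {c x lam : ℝ} {k : ℕ}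

theorem hyperbolaArea_one : hyperbolaArea 1 = 0 := by simp [hyperbolaArea]

theorem hasDerivAt_hyperbolaArea (hc : c ≠ 0) : HasDerivAt hyperbolaArea (Real.log c) c := by
  refine (((hasDerivAt_const c 1).fun_sub (hasDerivAt_id' c)).fun_add
    ((hasDerivAt_id' c).fun_mul (Real.hasDerivAt_log hc))).congr_deriv ?_
  field_simp
  ring

/-- Limiting proportion (relative to `Q ^ 2`) of the pairs of fractions in `(0, 1)` whose
difference is positive and at most `lam / N`. -/
def positivePairDensity (lam : ℝ) : ℝ :=
  ∑ k ∈ Finset.Icc 1 ⌊2 * lam⌋₊, meanWeight k * hyperbolaArea (k / (2 * lam))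

/-- The `k`-th summand of `density`, extended by zero to `x < k / 2`. -/
def densityTerm (k : ℕ) (x : ℝ) : ℝ :=
  6 / (Real.pi ^ 2 * x ^ 2) * (sigma 1 k * max 0 (Real.log (2 * x / k)))

theorem densityTerm_of_two_mul_le (hx : 0 ≤ x) (hxk : 2 * x ≤ k) : densityTerm k x = 0 := by
  rw [densityTerm, max_eq_left, mul_zero, mul_zero]
  exact Real.log_nonpos (by positivity) (div_le_one_of_le₀ hxk k.cast_nonneg)

theorem densityTerm_of_le_two_mul (hk : 0 < k) (hxk : k ≤ 2 * x) :
    densityTerm k x = 6 / (Real.pi ^ 2 * x ^ 2) * (sigma 1 k * Real.log (2 * x / k)) := by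
  rw [densityTerm, max_eq_right]
  exact Real.log_nonneg ((one_le_div (Nat.cast_pos.2 hk)).2 hxk)

theorem mem_Icc_one_floor : k ∈ Finset.Icc 1 ⌊x⌋₊ ↔ 0 < k ∧ (k : ℝ) ≤ x := by
  rw [Finset.mem_Icc, Nat.succ_le_iff]
  exact and_congr_right fun hk => Nat.le_floor_iff' hk.ne'

theorem density_eq_sum_densityTerm (hx : 0 ≤ x) (hxl : x ≤ lam) :
    density x = ∑ k ∈ Finset.Icc 1 ⌊2 * lam⌋₊, densityTerm k x := by
  have hsub : Finset.Icc 1 ⌊2 * x⌋₊ ⊆ Finset.Icc 1 ⌊2 * lam⌋₊ :=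
    Finset.Icc_subset_Icc_right (Nat.floor_mono (by linarith))
  rw [density, Finset.mul_sum, ← Finset.sum_subset hsub]
  · refine Finset.sum_congr rfl fun k hk => ?_
    obtain ⟨hk₀, hkx⟩ := mem_Icc_one_floor.1 hk
    rw [densityTerm_of_le_two_mul hk₀ hkx]
  · intro k hk hk'
    have hlt : ⌊2 * x⌋₊ < k := not_le.1 fun hle =>
      hk' (Finset.mem_Icc.2 ⟨(Finset.mem_Icc.1 hk).1, hle⟩)
    exact densityTerm_of_two_mul_le hx (Nat.lt_of_floor_lt hlt).le

theorem hasDerivAt_hyperbolaArea_div_two_mul (hk : 0 < k) (hx : 0 < x) :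
    HasDerivAt (fun x => hyperbolaArea (k / (2 * x)))
      (k / (2 * x ^ 2) * Real.log (2 * x / k)) x := by
  have : (k : ℝ) ≠ 0 := Nat.cast_ne_zero.2 hk.ne'
  have hinner : HasDerivAt (fun x : ℝ => (k : ℝ) / (2 * x)) (-(k / (2 * x ^ 2))) x := by
    refine ((hasDerivAt_const x (k : ℝ)).fun_div
      ((hasDerivAt_id' x).const_mul 2) (by positivity)).congr_deriv ?_
    field_simp
    ring
  refine ((hasDerivAt_hyperbolaArea (by positivity)).comp x hinner).congr_deriv ?_
  rw [← inv_div (2 * x), Real.log_inv]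
  ring

theorem hasDerivAt_meanWeight_mul_hyperbolaArea (hk : 0 < k) (hx : k ≤ 2 * x) :
    HasDerivAt (fun x => 2 * (meanWeight k * hyperbolaArea (k / (2 * x)))) (densityTerm k x) x := by
  have hx₀ : 0 < x := by linarith [(Nat.cast_pos.2 hk : (0 : ℝ) < k)]
  refine (((hasDerivAt_hyperbolaArea_div_two_mul hk hx₀).const_mul _).const_mul _).congr_deriv ?_
  rw [densityTerm_of_le_two_mul hk hx, meanWeight]
  field_simp

theorem continuousOn_densityTerm (hk : 0 < k) :
    ContinuousOn (densityTerm k) (Set.Ioi 0) := by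
  refine (continuousOn_const.div (by fun_prop) fun x (hx : 0 < x) => by positivity).mul
    (continuousOn_const.mul ?_)
  exact (continuous_const.max continuous_id).comp_continuousOn
    (ContinuousOn.log (by fun_prop) fun x (hx : 0 < x) => by positivity)

theorem intervalIntegrable_densityTerm_zero_half (k : ℕ) :
    IntervalIntegrable (densityTerm k) volume 0 (k / 2) := by
  refine (intervalIntegrable_const (c := (0 : ℝ))).congr fun x hx => ?_
  rw [Set.uIoc_of_le (by positivity)] at hx
  exact (densityTerm_of_two_mul_le hx.1.le (by linarith [hx.2])).symm

theorem intervalIntegrable_densityTerm_half (hk : 0 < k) (hkl : (k : ℝ) ≤ 2 * lam) :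
    IntervalIntegrable (densityTerm k) volume (k / 2) lam := by
  have hk₀ : (0 : ℝ) < k / 2 := by positivity
  exact ContinuousOn.intervalIntegrable_of_Icc (by linarith)
    ((continuousOn_densityTerm hk).mono fun x hx => hk₀.trans_le hx.1)

theorem intervalIntegrable_densityTerm (hk : k ∈ Finset.Icc 1 ⌊2 * lam⌋₊) :
    IntervalIntegrable (densityTerm k) volume 0 lam := by
  obtain ⟨hk₀, hkl⟩ := mem_Icc_one_floor.1 hk
  exact (intervalIntegrable_densityTerm_zero_half k).trans
    (intervalIntegrable_densityTerm_half hk₀ hkl)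

theorem integral_densityTerm (hk : k ∈ Finset.Icc 1 ⌊2 * lam⌋₊) :
    ∫ x in (0 : ℝ)..lam, densityTerm k x = 2 * (meanWeight k * hyperbolaArea (k / (2 * lam))) := by
  obtain ⟨hk₀, hkl⟩ := mem_Icc_one_floor.1 hk
  have hright := intervalIntegrable_densityTerm_half hk₀ hkl
  have hzero : ∫ x in (0 : ℝ)..(k / 2), densityTerm k x = 0 :=
    intervalIntegral.integral_zero_ae <| Eventually.of_forall fun x hx => by
      rw [Set.uIoc_of_le (by positivity)] at hx
      exact densityTerm_of_two_mul_le hx.1.le (by linarith [hx.2])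
  have hderiv : ∀ x ∈ Set.uIcc ((k : ℝ) / 2) lam, HasDerivAt
      (fun x => 2 * (meanWeight k * hyperbolaArea (k / (2 * x)))) (densityTerm k x) x := by
    intro x hx
    rw [Set.uIcc_of_le (by linarith)] at hx
    exact hasDerivAt_meanWeight_mul_hyperbolaArea hk₀ (by linarith [hx.1])
  rw [← intervalIntegral.integral_add_adjacent_intervals
      (intervalIntegrable_densityTerm_zero_half k) hright, hzero,
    intervalIntegral.integral_eq_sub_of_hasDerivAt hderiv hright,
    mul_div_cancel₀ _ two_ne_zero, div_self (Nat.cast_ne_zero.2 hk₀.ne'), hyperbolaArea_one]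
  ring

theorem eqOn_density (hl : 0 ≤ lam) :
    Set.EqOn (fun x => ∑ k ∈ Finset.Icc 1 ⌊2 * lam⌋₊, densityTerm k x) density
      (Set.uIoc 0 lam) := by
  intro x hx
  rw [Set.uIoc_of_le hl] at hx
  exact (density_eq_sum_densityTerm hx.1.le hx.2).symm

theorem intervalIntegrable_density (hl : 0 ≤ lam) : IntervalIntegrable density volume 0 lam := by
  refine IntervalIntegrable.congr (eqOn_density hl) ?_
  simp only [← Finset.sum_apply]
  exact IntervalIntegrable.sum _ fun k hk => intervalIntegrable_densityTerm hk

theorem integral_density (hl : 0 ≤ lam) :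
    ∫ x in (0 : ℝ)..lam, density x = 2 * positivePairDensity lam := by
  rw [← intervalIntegral.integral_congr_ae (Eventually.of_forall (eqOn_density hl)),
    intervalIntegral.integral_finsetSum fun k hk => intervalIntegrable_densityTerm hk,
    positivePairDensity, Finset.mul_sum]
  exact Finset.sum_congr rfl fun k hk => integral_densityTerm hk

end Density

section NumPoints

theorem numPoints_pos {Q : ℕ} (hQ : 2 ≤ Q) : 0 < numPoints Q := by
  have hQ₂ : (2 : ℝ) ≤ Q := Nat.ofNat_le_cast.2 hQ
  rw [numPoints]
  exact div_pos (mul_pos (by linarith) (by linarith)) two_pos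

theorem numPoints_le (Q : ℕ) : numPoints Q ≤ (Q : ℝ) ^ 2 / 2 := by
  rw [numPoints]
  nlinarith [Nat.cast_nonneg (α := ℝ) Q]

theorem tendsto_numPoints_div_sq :
    Tendsto (fun Q : ℕ => numPoints Q / (Q : ℝ) ^ 2) atTop (𝓝 (1 / 2)) := by
  have hlim := (tendsto_one_div_atTop_nhds_zero_nat (𝕜 := ℝ)).const_sub 1 |>.div_const 2
  rw [sub_zero] at hlim
  refine hlim.congr' ?_
  filter_upwards [eventually_ne_atTop 0] with Q hQ
  rw [numPoints]
  field_simp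

end NumPoints

section PositivePairs

variable {I J : Set ℝ} {Q k : ℕ} {lam t : ℝ}

open scoped Classical in
/-- The pairs counted by `closePairs` whose first entry is the larger one. -/
def positivePairs (I : Set ℝ) (Q : ℕ) (lam : ℝ) : Finset ((ℕ × ℕ) × (ℕ × ℕ)) :=
  (closePairs I Q lam).filter fun ij => point ij.2 < point ij.1

theorem mem_positivePairs {ij : (ℕ × ℕ) × (ℕ × ℕ)} :
    ij ∈ positivePairs I Q lam ↔ (ij.1 ∈ indices Q ∧ ij.2 ∈ indices Q) ∧
      point ij.1 ∈ I ∧ point ij.2 ∈ I ∧ point ij.2 < point ij.1 ∧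
        point ij.1 - point ij.2 ≤ lam / numPoints Q := by
  simp only [positivePairs, closePairs, Finset.mem_filter, Finset.mem_product]
  constructor
  · rintro ⟨⟨hij, hmem₁, hmem₂, -, -, hdist⟩, hlt⟩
    exact ⟨hij, hmem₁, hmem₂, hlt, (le_abs_self _).trans hdist⟩
  · rintro ⟨hij, hmem₁, hmem₂, hlt, hdist⟩
    have hpos := sub_pos.2 hlt
    refine ⟨⟨hij, hmem₁, hmem₂, ne_of_apply_ne point hlt.ne', abs_pos.2 hpos.ne', ?_⟩, hlt⟩
    rwa [abs_of_pos hpos]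

theorem swap_mem_closePairs {ij : (ℕ × ℕ) × (ℕ × ℕ)} (hij : ij ∈ closePairs I Q lam) :
    ij.swap ∈ closePairs I Q lam := by
  simp only [closePairs, Finset.mem_filter, Finset.mem_product, Prod.fst_swap,
    Prod.snd_swap] at hij ⊢
  obtain ⟨⟨hi, hj⟩, hmem₁, hmem₂, hne, hdist⟩ := hij
  exact ⟨⟨hj, hi⟩, hmem₂, hmem₁, hne.symm, by rwa [abs_sub_comm]⟩

theorem card_closePairs (I : Set ℝ) (Q : ℕ) (lam : ℝ) :
    (closePairs I Q lam).card = 2 * (positivePairs I Q lam).card := by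
  classical
  have hswap : ((closePairs I Q lam).filter fun ij => ¬ point ij.2 < point ij.1).card =
      (positivePairs I Q lam).card := by
    refine Finset.card_nbij' Prod.swap Prod.swap ?_ ?_ (fun _ _ => Prod.swap_swap _)
      (fun _ _ => Prod.swap_swap _)
    · intro ij hij
      obtain ⟨hmem, hle⟩ := Finset.mem_filter.1 hij
      have hne : point ij.1 ≠ point ij.2 :=
        sub_ne_zero.1 (abs_pos.1 (Finset.mem_filter.1 hmem).2.2.2.2.1)
      exact Finset.mem_filter.2 ⟨swap_mem_closePairs hmem, (not_lt.1 hle).lt_of_ne hne⟩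
    · intro ij hij
      obtain ⟨hmem, hlt⟩ := Finset.mem_filter.1 hij
      exact Finset.mem_filter.2 ⟨swap_mem_closePairs hmem, hlt.not_gt⟩
  rw [← Finset.card_filter_add_card_filter_not fun ij => point ij.2 < point ij.1, hswap, two_mul]
  rfl

theorem card_positivePairs_mono (hIJ : I ⊆ J) (Q : ℕ) (lam : ℝ) :
    (positivePairs I Q lam).card ≤ (positivePairs J Q lam).card := by
  refine Finset.card_le_card fun ij hij => ?_
  obtain ⟨hmem, hmem₁, hmem₂, hclose⟩ := mem_positivePairs.1 hij
  exact mem_positivePairs.2 ⟨hmem, hIJ hmem₁, hIJ hmem₂, hclose⟩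

theorem card_positivePairs_add_le (hIJ : Disjoint I J) (Q : ℕ) (lam : ℝ) :
    (positivePairs I Q lam).card + (positivePairs J Q lam).card ≤
      (positivePairs (I ∪ J) Q lam).card := by
  classical
  rw [← Finset.card_union_of_disjoint]
  · refine Finset.card_le_card (Finset.union_subset ?_ ?_) <;> intro ij hij <;>
      obtain ⟨hmem, hmem₁, hmem₂, hclose⟩ := mem_positivePairs.1 hij
    · exact mem_positivePairs.2 ⟨hmem, Or.inl hmem₁, Or.inl hmem₂, hclose⟩
    · exact mem_positivePairs.2 ⟨hmem, Or.inr hmem₁, Or.inr hmem₂, hclose⟩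
  · exact Finset.disjoint_left.2 fun ij hijI hijJ => Set.disjoint_left.1 hIJ
      (mem_positivePairs.1 hijI).2.1 (mem_positivePairs.1 hijJ).2.1

theorem snd_pos_of_mem_indices {i : ℕ × ℕ} (hi : i ∈ indices Q) : 0 < i.2 :=
  (Nat.zero_le _).trans_lt (mem_indices.1 hi).2.1

theorem point_sub_point {i j : ℕ × ℕ} (hi : 0 < i.2) (hj : 0 < j.2)
    (hdet : i.1 * j.2 = j.1 * i.2 + k) : point i - point j = k / ((i.2 : ℝ) * j.2) := by
  have hdet' : (i.1 : ℝ) * j.2 = j.1 * i.2 + k := mod_cast hdet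
  rw [point, point]
  field_simp
  linear_combination hdet'

theorem exists_det_eq_of_point_lt {i j : ℕ × ℕ} (hi : 0 < i.2) (hj : 0 < j.2)
    (hij : point j < point i) : ∃ k, 0 < k ∧ i.1 * j.2 = j.1 * i.2 + k := by
  rw [point, point, div_lt_div_iff₀ (Nat.cast_pos.2 hj) (Nat.cast_pos.2 hi)] at hij
  have hlt : j.1 * i.2 < i.1 * j.2 := mod_cast hij
  exact ⟨i.1 * j.2 - j.1 * i.2, Nat.sub_pos_of_lt hlt, (Nat.add_sub_cancel' hlt.le).symm⟩

theorem detPairs_subset_positivePairs (hl : 0 < lam) (hk : 0 < k) (hQ : 2 ≤ Q) :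
    detPairs I Q k (k / (2 * lam)) ⊆ positivePairs I Q lam := by
  intro ij hij
  obtain ⟨hmem, hmem₁, hmem₂, hdet, hlarge⟩ := mem_detPairs.1 hij
  have hi := snd_pos_of_mem_indices hmem.1
  have hj := snd_pos_of_mem_indices hmem.2
  have hsub := point_sub_point hi hj hdet
  refine mem_positivePairs.2 ⟨hmem, hmem₁, hmem₂, sub_pos.1 ?_, ?_⟩
  · rw [hsub]
    positivity
  · rw [hsub, div_le_div_iff₀ (by positivity) (numPoints_pos hQ)]
    calc k * numPoints Q ≤ k * ((Q : ℝ) ^ 2 / 2) := by gcongr; exact numPoints_le Q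
      _ = lam * (k / (2 * lam) * (Q : ℝ) ^ 2) := by field_simp
      _ ≤ lam * (ij.1.2 * ij.2.2) := by gcongr

theorem sum_card_detPairs_le (hl : 0 < lam) (hQ : 2 ≤ Q) :
    ∑ k ∈ Finset.Icc 1 ⌊2 * lam⌋₊, (detPairs I Q k (k / (2 * lam))).card ≤
      (positivePairs I Q lam).card := by
  rw [← Finset.card_biUnion]
  · exact Finset.card_le_card (Finset.biUnion_subset.2 fun k hk =>
      detPairs_subset_positivePairs hl (mem_Icc_one_floor.1 hk).1 hQ)
  · intro k _ l _ hkl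
    refine Finset.disjoint_left.2 fun ij hijk hijl => hkl ?_
    have hdet := (mem_detPairs.1 hijk).2.2.2.1.symm.trans (mem_detPairs.1 hijl).2.2.2.1
    exact Nat.add_left_cancel hdet

theorem positivePairs_subset_biUnion (hl : 0 < lam) (hQ : 2 ≤ Q) (ht : 0 < t)
    (hfloor : 2 * lam < t * (⌊2 * lam⌋₊ + 1)) (hN : t * ((Q : ℝ) ^ 2 / 2) ≤ numPoints Q) :
    positivePairs I Q lam ⊆ (Finset.Icc 1 ⌊2 * lam⌋₊).biUnion
      fun k => detPairs I Q k (t * (k / (2 * lam))) := by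
  intro ij hij
  obtain ⟨hmem, hmem₁, hmem₂, hlt, hclose⟩ := mem_positivePairs.1 hij
  have hi := snd_pos_of_mem_indices hmem.1
  have hj := snd_pos_of_mem_indices hmem.2
  obtain ⟨k, hk, hdet⟩ := exists_det_eq_of_point_lt hi hj hlt
  rw [point_sub_point hi hj hdet, div_le_div_iff₀ (by positivity) (numPoints_pos hQ)] at hclose
  have hbound : k * (t * ((Q : ℝ) ^ 2 / 2)) ≤ lam * (ij.1.2 * ij.2.2) :=
    (mul_le_mul_of_nonneg_left hN k.cast_nonneg).trans hclose
  have hden : (ij.1.2 * ij.2.2 : ℝ) ≤ (Q : ℝ) ^ 2 := by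
    rw [sq]
    gcongr
    exacts [(mem_indices.1 hmem.1).2.2, (mem_indices.1 hmem.2).2.2]
  have hkt : t * k ≤ 2 * lam := by
    have hQ₀ : (0 : ℝ) < (Q : ℝ) ^ 2 := by positivity
    nlinarith [mul_le_mul_of_nonneg_left hden hl.le]
  have hkfloor : (k : ℝ) < ⌊2 * lam⌋₊ + 1 :=
    lt_of_mul_lt_mul_left (hkt.trans_lt hfloor) ht.le
  refine Finset.mem_biUnion.2 ⟨k, Finset.mem_Icc.2 ⟨hk, Nat.lt_succ_iff.1 (mod_cast hkfloor)⟩,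
    mem_detPairs.2 ⟨hmem, hmem₁, hmem₂, hdet, ?_⟩⟩
  calc t * (k / (2 * lam)) * (Q : ℝ) ^ 2 = k * (t * ((Q : ℝ) ^ 2 / 2)) / lam := by field_simp
    _ ≤ (ij.1.2 : ℝ) * ij.2.2 := by rwa [div_le_iff₀' hl]

theorem card_positivePairs_le (hl : 0 < lam) (hQ : 2 ≤ Q) (ht : 0 < t)
    (hfloor : 2 * lam < t * (⌊2 * lam⌋₊ + 1)) (hN : t * ((Q : ℝ) ^ 2 / 2) ≤ numPoints Q) :
    (positivePairs I Q lam).card ≤ ∑ k ∈ Finset.Icc 1 ⌊2 * lam⌋₊,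
      ∑ v ∈ latticePoints (aboveHyperbola (t * (k / (2 * lam)))) Q, gcdWeight k v :=
  (Finset.card_le_card (positivePairs_subset_biUnion hl hQ ht hfloor hN)).trans
    (Finset.card_biUnion_le.trans (Finset.sum_le_sum fun k _ => card_detPairs_le I Q k _))

end PositivePairs

section Limits

variable {I : Set ℝ} {a b lam t : ℝ}

theorem liminfGE_card_positivePairs (hl : 0 < lam) (ha : 0 ≤ a) (hab : a ≤ b) (hb : b ≤ 1)
    (hI : Set.Ioo a b ⊆ I) :
    LiminfGE atTop (fun Q : ℕ => ((positivePairs I Q lam).card : ℝ) / (Q : ℝ) ^ 2)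
      (positivePairDensity lam * (b - a)) := by
  have hlower : ∀ k ∈ Finset.Icc 1 ⌊2 * lam⌋₊, LiminfGE atTop
      (fun Q : ℕ => ((detPairs (Set.Ioo a b) Q k (k / (2 * lam))).card : ℝ) / (Q : ℝ) ^ 2)
      (meanWeight k * hyperbolaArea (k / (2 * lam)) * (b - a)) := by
    intro k hk
    obtain ⟨hk₀, hkl⟩ := mem_Icc_one_floor.1 hk
    exact liminfGE_card_detPairs hk₀ (by positivity) (div_le_one_of_le₀ hkl (by positivity))
      ha hab hb
  rw [positivePairDensity, Finset.sum_mul]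
  refine (LiminfGE.sum hlower).mono ?_
  filter_upwards [eventually_ge_atTop 2] with Q hQ
  rw [← Finset.sum_div, ← Nat.cast_sum]
  gcongr
  exact (sum_card_detPairs_le hl hQ).trans (card_positivePairs_mono hI Q lam)

theorem liminfGE_neg_card_positivePairs_of_lt_one (I : Set ℝ) (hl : 0 < lam) (ht : 0 < t)
    (ht1 : t < 1) (hfloor : 2 * lam < t * (⌊2 * lam⌋₊ + 1)) :
    LiminfGE atTop (fun Q : ℕ => -(((positivePairs I Q lam).card : ℝ) / (Q : ℝ) ^ 2))
      (-∑ k ∈ Finset.Icc 1 ⌊2 * lam⌋₊, meanWeight k * hyperbolaArea (t * (k / (2 * lam)))) := by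
  have hlim : Tendsto (fun Q : ℕ => ∑ k ∈ Finset.Icc 1 ⌊2 * lam⌋₊,
      (∑ v ∈ latticePoints (aboveHyperbola (t * (k / (2 * lam)))) Q, (gcdWeight k v : ℝ)) /
        (Q : ℝ) ^ 2) atTop
      (𝓝 (∑ k ∈ Finset.Icc 1 ⌊2 * lam⌋₊, meanWeight k * hyperbolaArea (t * (k / (2 * lam))))) := by
    refine tendsto_finsetSum _ fun k hk => ?_
    obtain ⟨hk₀, hkl⟩ := mem_Icc_one_floor.1 hk
    have hc : 0 < t * (k / (2 * lam)) := by positivity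
    have hc1 : t * (k / (2 * lam)) ≤ 1 :=
      mul_le_one₀ ht1.le (by positivity) (div_le_one_of_le₀ hkl (by positivity))
    rw [← volume_real_aboveHyperbola hc hc1]
    exact (isJordanRegion_aboveHyperbola hc.le).tendsto_sum_gcdWeight hk₀
  have ht2 : t * (1 / 2) < 1 / 2 := by linarith
  refine (LiminfGE.of_tendsto hlim.neg).mono ?_
  filter_upwards [eventually_ge_atTop 2, tendsto_numPoints_div_sq.eventually_const_lt ht2]
    with Q hQ hN
  have hQ₀ : (0 : ℝ) < (Q : ℝ) ^ 2 := by positivity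
  rw [← Finset.sum_div, neg_le_neg_iff]
  gcongr
  refine mod_cast card_positivePairs_le hl hQ ht hfloor ?_
  exact (((lt_div_iff₀ hQ₀).1 hN).le).trans_eq' (by ring)

theorem liminfGE_neg_card_positivePairs (I : Set ℝ) (hl : 0 < lam) :
    LiminfGE atTop (fun Q : ℕ => -(((positivePairs I Q lam).card : ℝ) / (Q : ℝ) ^ 2))
      (-positivePairDensity lam) := by
  have hcont : Tendsto (fun t : ℝ => ∑ k ∈ Finset.Icc 1 ⌊2 * lam⌋₊,
      meanWeight k * hyperbolaArea (t * (k / (2 * lam)))) (𝓝[<] 1)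
      (𝓝 (positivePairDensity lam)) := by
    refine tendsto_finsetSum _ fun k hk => Tendsto.const_mul _ ?_
    have hk₀ : (0 : ℝ) < k := Nat.cast_pos.2 (mem_Icc_one_floor.1 hk).1
    exact ((hasDerivAt_hyperbolaArea (by positivity)).continuousAt.tendsto).comp
      ((continuous_mul_const _).tendsto' _ _ (one_mul _) |>.mono_left nhdsWithin_le_nhds)
  have hfloor : ∀ᶠ t : ℝ in 𝓝[<] 1, 2 * lam < t * (⌊2 * lam⌋₊ + 1) :=
    ((continuous_mul_const _).tendsto' _ _ (one_mul _) |>.mono_left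
      nhdsWithin_le_nhds).eventually_const_lt (Nat.lt_floor_add_one _)
  refine LiminfGE.closure hcont.neg ?_
  filter_upwards [hfloor, Ioo_mem_nhdsLT one_pos] with t hfloor ht
  exact liminfGE_neg_card_positivePairs_of_lt_one I hl ht.1 ht.2 hfloor

theorem card_positivePairs_Ioo_add_add_le (hab : a ≤ b) (hI : I ⊆ Set.Icc a b) (Q : ℕ) (lam : ℝ) :
    (positivePairs (Set.Ioo 0 a) Q lam).card + (positivePairs I Q lam).card +
      (positivePairs (Set.Ioo b 1) Q lam).card ≤ (positivePairs Set.univ Q lam).card := by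
  have hleft : Disjoint (Set.Ioo 0 a) I :=
    Set.disjoint_left.2 fun x hx hxI => hx.2.not_ge (hI hxI).1
  have hright : Disjoint (Set.Ioo 0 a ∪ I) (Set.Ioo b 1) := by
    refine Set.disjoint_left.2 fun x hx hxb => hxb.1.not_ge ?_
    exact hx.elim (fun hx => hx.2.le.trans hab) fun hx => (hI hx).2
  exact (Nat.add_le_add_right (card_positivePairs_add_le hleft Q lam) _).trans
    ((card_positivePairs_add_le hright Q lam).trans
      (card_positivePairs_mono (Set.subset_univ _) Q lam))

theorem tendsto_card_positivePairs (hl : 0 < lam) (ha : 0 ≤ a) (hab : a ≤ b) (hb : b ≤ 1)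
    (hI : Set.Ioo a b ⊆ I) (hI' : I ⊆ Set.Icc a b) :
    Tendsto (fun Q : ℕ => ((positivePairs I Q lam).card : ℝ) / (Q : ℝ) ^ 2) atTop
      (𝓝 (positivePairDensity lam * (b - a))) := by
  refine (liminfGE_card_positivePairs hl ha hab hb hI).tendsto ?_
  have hcompl := ((liminfGE_neg_card_positivePairs Set.univ hl).add
    (liminfGE_card_positivePairs hl le_rfl ha (hab.trans hb) subset_rfl)).add
    (liminfGE_card_positivePairs hl (ha.trans hab) hb le_rfl subset_rfl)
  refine (hcompl.mono (Eventually.of_forall fun Q => ?_)).anti (le_of_eq (by ring))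
  have hcard : ((positivePairs (Set.Ioo 0 a) Q lam).card + (positivePairs I Q lam).card +
      (positivePairs (Set.Ioo b 1) Q lam).card : ℝ) / (Q : ℝ) ^ 2 ≤
      (positivePairs Set.univ Q lam).card / (Q : ℝ) ^ 2 := by
    gcongr
    exact_mod_cast card_positivePairs_Ioo_add_add_le hab hI' Q lam
  simp only [add_div] at hcard
  linarith

theorem volume_real_of_Ioo_subset_of_subset_Icc (hab : a ≤ b) (hI : Set.Ioo a b ⊆ I)
    (hI' : I ⊆ Set.Icc a b) : volume.real I = b - a := by
  refine le_antisymm ?_ ?_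
  · rw [← Real.volume_real_Icc_of_le hab]
    exact measureReal_mono hI' measure_Icc_lt_top.ne
  · rw [← Real.volume_real_Ioo_of_le hab]
    exact measureReal_mono hI ((measure_mono hI').trans_lt measure_Icc_lt_top).ne

theorem tendsto_pairCorr (hl : 0 < lam) (ha : 0 ≤ a) (hab : a < b) (hb : b ≤ 1)
    (hI : Set.Ioo a b ⊆ I) (hI' : I ⊆ Set.Icc a b) :
    Tendsto (fun Q : ℕ => pairCorr I Q lam) atTop (𝓝 (2 * positivePairDensity lam)) := by
  have hba : 0 < b - a := sub_pos.2 hab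
  have hlim := ((tendsto_card_positivePairs hl ha hab.le hb hI hI').div tendsto_numPoints_div_sq
    one_half_pos.ne').div_const (b - a)
  rw [show positivePairDensity lam * (b - a) / (1 / 2) / (b - a) = 2 * positivePairDensity lam by
    field_simp] at hlim
  refine hlim.congr' ?_
  filter_upwards [eventually_ge_atTop 2] with Q hQ
  have hN := numPoints_pos hQ
  rw [pairCorr, card_closePairs, volume_real_of_Ioo_subset_of_subset_Icc hab.le hI hI',
    Pi.div_apply]
  push_cast
  field_simp

end Limits

end FracPairCorr

end

theorem mainTheorem2 (I : Set ℝ) (hconn : I.OrdConnected) (hne : I.Nontrivial)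
    (hI : I ⊆ Set.Ioo (0 : ℝ) 1) :
    FracPairCorr.IsPairCorrelationFunction I FracPairCorr.density := by
  intro lam hl
  refine ⟨FracPairCorr.intervalIntegrable_density hl.le, ?_⟩
  rw [FracPairCorr.integral_density hl.le]
  have hconnected : IsConnected I := ⟨hne.nonempty, hconn.isPreconnected⟩
  have hbelow : BddBelow I := bddBelow_Ioo.mono hI
  have habove : BddAbove I := bddAbove_Ioo.mono hI
  obtain ⟨x, hx, y, hy, hxy⟩ := hne.exists_lt
  exact FracPairCorr.tendsto_pairCorr hl
    (le_csInf hne.nonempty fun z hz => (hI hz).1.le)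
    ((csInf_le hbelow hx).trans_lt (hxy.trans_le (le_csSup habove hy)))
    (csSup_le hne.nonempty fun z hz => (hI hz).2.le)
    (hconnected.Ioo_csInf_csSup_subset hbelow habove)
    (subset_Icc_csInf_csSup hbelow habove)
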